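/- Let $d\ge 1$, $K=\lfloor d/2\rfloor+1$ and $\mathbb T^d=(\mathbb R/2\pi\mathbb Z)^d$. For a continuous function $f$ on $\mathbb T^d$ put $c_n(f)=\int_{[0,2\pi]^d} f(\theta)\,\mathrm e^{-\mathrm i\langle n,\theta\rangle}\frac{d\theta}{(2\pi)^d}$ ($n\in\mathbb Z^d$) and $\|f\|_{\mathscr A}=\sum_{n\in\mathbb Z^d}|c_n(f)|$; the Wiener algebra $\mathscr A$ is the set of such $f$ with $\|f\|_{\mathscr A}<\infty$. For a signed measure $\mu$ on $\mathbb Z^d$ put $\widehat\mu(\xi)=\sum_{k\in\mathbb Z^d}\mu(\{k\})\,\mathrm e^{\mathrm i\langle k,\xi\rangle}$. For $i=1,\dots,d$ let $\phi_i$ be the Lévy–Khintchine exponent of an infinitely divisible probability measure $\rho_i$ on $\mathbb Z$ (that is, $\phi_i$ is continuous and $2\pi$-periodic, $\phi_i(0)=0$, $\widehat{\rho_i}=\mathrm e^{\phi_i}$, and $\mathrm e^{\phi_i/n}$ is the Fourier transform of a probability measure on $\mathbb Z$ for every $n\ge1$). Assume that $\rho_i$ is not supported on any proper subgroup of $\mathbb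 Z$ and has finite moments up to order $\max(2,K)$. Write $\phi(\xi)=\sum_{i=1}^d\phi_i(\xi_i)$, let $\phi_i(\theta)=\mathrm i m_i\theta-\frac{\sigma_i^2\theta^2}{2}+o(\theta^2)$ be the Taylor expansion at $0$, and set $$\gamma(\varepsilon)=\sup_{i}\sup_{|\theta|\le\varepsilon}|\phi_i''(\theta)+\sigma_i^2|,\qquad M=-\sup_{i}\sup_{0<|\theta|\le\pi}\frac{\Re\phi_i(\theta)}{\theta^2}.$$ For an integer $r\ge\lfloor d/2\rfloor$ and a real $\lambda>0$ consider signed measures $\mu,\nu$ on $\mathbb Z^d$ with $$\widehat\mu=\mathrm e^{\lambda\phi}\psi,\qquad \widehat\nu=\mathrm e^{\lambda\phi}\chi,$$ where $\psi,\chi:\mathbb T^d\to\mathbb C$ are of class $\mathscr C^{r+1}$ and $\partial^\alpha(\psi-\chi)(0)=0$ for all multi-indices $|\alpha|\le r$. Set $\beta_{r+1}(\varepsilon)=\sup_{|\alpha|=r+1}\sup_{\xi\in[-\varepsilon,\varepsilon]^d}|\partial^\alpha(\psi-\chi)(\xi)|$. Then $\psi-\chi$ and $\widehat\mu-\widehat\nu$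 belong to $\mathscr A$, and the following hold. (1) For every $\lambda_0>0$ there are positive constants $C_1,C_2$, depending only on $d$, $\phi$ and $\lambda_0$, such that for all $r\ge\lfloor d/2\rfloor$, all $\lambda\ge\lambda_0$, all $\mu,\nu,\psi,\chi$ as above and all $\varepsilon\in(0,1)$ with $\gamma(\varepsilon)\le\min_i\frac{\sigma_i^2}{2}$, $$\|\widehat\mu-\widehat\nu\|_{\mathscr A}\le C_1\left(\|\psi-\chi\|_{\mathscr A}\,\frac{\lambda^K\mathrm e^{-\lambda M\varepsilon^2/4}}{\varepsilon}+\frac{\varepsilon^{r+1}\beta_{r+1}(\varepsilon)}{\lambda^{d/4}}\left(\sqrt\lambda+\frac1\varepsilon\right)^{K}\right)\left(1+\frac{C_2}{\sqrt\lambda}\right).$$ (2) For every $r\ge\lfloor d/2\rfloor$ there is a constant $C_3>0$, depending only on $r$, $d$ and $\phi$, such that for every $\varepsilon>0$ there is $\lambda_1\ge 2$ (depending only on $\varepsilon,r,d,\phi$) such that for all $\lambda\ge\lambda_1$ and all $\mu,\nu,\psi,\chi$ as above, $$\|\widehat\mu-\widehat\nu\|_{\mathscr A}\le C_3\left(\|\psi-\chi\|_{\mathscr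 A}+\beta_{r+1}(\varepsilon)\right)\frac{(\log\lambda)^{r+1}}{\lambda^{\frac r2+\frac14}}.$$ -/

import Mathlib

open MeasureTheory

noncomputable section

namespace MultiWiener

/-- `K_d = ⌊d/2⌋ + 1`. -/
def K (d : ℕ) : ℕ := d / 2 + 1

/-- `f` is `2π`-periodic in each coordinate. Functions on the torus `(ℝ / 2πℤ)^d` are represented by
such functions on `ℝ^d`. -/
def TorusPeriodic {d : ℕ} (f : (Fin d → ℝ) → ℂ) : Prop :=
  ∀ (ξ : Fin d → ℝ) (i : Fin d), f (ξ + Pi.single i (2 * Real.pi)) = f ξ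

/-- The Fourier coefficient `c_n(f) = ∫_{[0,2π]^d} f(θ) exp(-i ⟨n,θ⟩) dθ / (2π)^d`. -/
def fourierCoeff {d : ℕ} (f : (Fin d → ℝ) → ℂ) (n : Fin d → ℤ) : ℂ :=
  (1 / (2 * (Real.pi : ℂ)) ^ d) *
    ∫ θ in Set.Icc (0 : Fin d → ℝ) (fun _ => 2 * Real.pi),
      f θ * Complex.exp (-(Complex.I * ∑ j, (n j : ℂ) * (θ j : ℂ)))

/-- Membership in the Wiener algebra `𝒜(𝕋^d)`. -/
structure MemWiener {d : ℕ} (f : (Fin d → ℝ) → ℂ) : Prop where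
  periodic : TorusPeriodic f
  continuous : Continuous f
  summable : Summable fun n : Fin d → ℤ => ‖fourierCoeff f n‖

/-- The Wiener norm `‖f‖_𝒜 = ∑_{n ∈ ℤ^d} |c_n(f)|`. -/
def wienerNorm {d : ℕ} (f : (Fin d → ℝ) → ℂ) : ℝ :=
  ∑' n : Fin d → ℤ, ‖fourierCoeff f n‖

/-- The Fourier transform `∑_k μ({k}) exp(i ⟨k,ξ⟩)` of a signed measure on `ℤ^d`. -/
def fourier {d : ℕ} (μ : SignedMeasure (Fin d → ℤ)) (ξ : Fin d → ℝ) : ℂ :=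
  ∑' k : Fin d → ℤ, ((μ {k} : ℝ) : ℂ) *
    Complex.exp (Complex.I * ∑ j, (k j : ℂ) * (ξ j : ℂ))

/-- The Fourier transform `∑_k ρ({k}) exp(i k θ)` of a measure on `ℤ`. -/
def fourierInt (ρ : Measure ℤ) (θ : ℝ) : ℂ :=
  ∫ k : ℤ, Complex.exp (Complex.I * (k : ℂ) * (θ : ℂ)) ∂ρ

/-- The probability measure `ρ` on `ℤ` is infinitely divisible with Lévy–Khintchine exponent `φ`:
`φ` is continuous and `2π`-periodic with `φ(0) = 0`, `exp φ` is the Fourier transform of `ρ`, and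
for every `n ≥ 1`, `exp (φ / n)` is the Fourier transform of a probability measure on `ℤ` (whose
`n`-th convolution power is then `ρ`). -/
structure IsLevyExponent (ρ : Measure ℤ) (φ : ℝ → ℂ) : Prop where
  continuous : Continuous φ
  periodic : Function.Periodic φ (2 * Real.pi)
  zero : φ 0 = 0
  fourier_eq : ∀ θ : ℝ, fourierInt ρ θ = Complex.exp (φ θ)
  divisible : ∀ n : ℕ, 1 ≤ n → ∃ ρn : Measure ℤ, IsProbabilityMeasure ρn ∧
    ∀ θ : ℝ, fourierInt ρn θ = Complex.exp (φ θ / (n : ℂ))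

/-- No proper sublattice (subgroup) of `ℤ` carries `ρ`. -/
def HasMinimalLattice (ρ : Measure ℤ) : Prop :=
  ∀ H : AddSubgroup ℤ, ρ ((H : Set ℤ)ᶜ) = 0 → H = ⊤

/-- `ρ` has a finite absolute moment of order `p`. -/
def HasMoment (p : ℕ) (ρ : Measure ℤ) : Prop :=
  Integrable (fun k : ℤ => |(k : ℝ)| ^ p) ρ

/-- The exponent `φ(ξ) = ∑_i φ_i(ξ_i)`. -/
def sumExponent {d : ℕ} (φ : Fin d → ℝ → ℂ) (ξ : Fin d → ℝ) : ℂ :=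
  ∑ i, φ i (ξ i)

/-- The coefficient `σ²` of the expansion `φ(θ) = i m θ - σ² θ² / 2 + o(θ²)` of an exponent of
class `𝒞²`, that is, `-φ''(0)`, which is real for a Lévy–Khintchine exponent. -/
def sigmaSq (φ : ℝ → ℂ) : ℝ :=
  -(iteratedDeriv 2 φ 0).re

/-- The partial derivative `∂_{s_1} ⋯ ∂_{s_n} f (ξ)`. For `f` of class `𝒞^n`, these are exactly the
derivatives `∂^α f (ξ)` with `|α| = n`, where `α_i` is the number of occurrences of `i` in `s`. -/
def partialDeriv {d n : ℕ} (s : Fin n → Fin d) (f : (Fin d → ℝ) → ℂ) (ξ : Fin d → ℝ) : ℂ :=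
  iteratedFDeriv ℝ n f ξ fun j => Pi.single (s j) 1

/-- For `f = ψ - χ` and `n = r + 1`, this is `β_{r+1}(ε)`: the supremum over `|α| = n` and
`ξ ∈ [-ε,ε]^d` of `|∂^α f (ξ)|`. -/
def betaSup {d : ℕ} (n : ℕ) (f : (Fin d → ℝ) → ℂ) (ε : ℝ) : ℝ :=
  sSup {x : ℝ | ∃ (s : Fin n → Fin d) (ξ : Fin d → ℝ),
    (∀ i, |ξ i| ≤ ε) ∧ x = ‖partialDeriv s f ξ‖}

/-- `γ(ε)`: the supremum over `i` and `θ ∈ [-ε,ε]` of `|φ_i''(θ) + σ_i²|`. -/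
def gammaSup {d : ℕ} (φ : Fin d → ℝ → ℂ) (ε : ℝ) : ℝ :=
  sSup {x : ℝ | ∃ (i : Fin d) (θ : ℝ),
    |θ| ≤ ε ∧ x = ‖iteratedDeriv 2 (φ i) θ + (sigmaSq (φ i) : ℂ)‖}

/-- `M`: minus the supremum over `i` and `θ ∈ [-π,π] \ {0}` of `Re φ_i(θ) / θ²`. -/
def decayM {d : ℕ} (φ : Fin d → ℝ → ℂ) : ℝ :=
  -sSup {x : ℝ | ∃ (i : Fin d) (θ : ℝ),
    |θ| ≤ Real.pi ∧ θ ≠ 0 ∧ x = (φ i θ).re / θ ^ 2}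

/-- The measures `μ`, `ν` have Fourier transforms `exp(lam φ) ψ` and `exp(lam φ) χ`, with residues
`ψ`, `χ` of class `𝒞^{r+1}` on the torus whose Taylor expansions at `0` agree up to order `r`. -/
structure ResidueScheme {d : ℕ} (φ : Fin d → ℝ → ℂ) (r : ℕ) (lam : ℝ)
    (μ ν : SignedMeasure (Fin d → ℤ)) (ψ χ : (Fin d → ℝ) → ℂ) : Prop where
  periodic_left : TorusPeriodic ψ
  periodic_right : TorusPeriodic χ
  contDiff_left : ContDiff ℝ ((r + 1 : ℕ) : WithTop ℕ∞) ψ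
  contDiff_right : ContDiff ℝ ((r + 1 : ℕ) : WithTop ℕ∞) χ
  fourier_left : ∀ ξ, fourier μ ξ = Complex.exp ((lam : ℂ) * sumExponent φ ξ) * ψ ξ
  fourier_right : ∀ ξ, fourier ν ξ = Complex.exp ((lam : ℂ) * sumExponent φ ξ) * χ ξ
  taylor : ∀ n : ℕ, n ≤ r → ∀ s : Fin n → Fin d, partialDeriv s (ψ - χ) 0 = 0

end MultiWiener

end

/-! Put h = ψ − χ, so that the difference of the two transforms is e^{λφ}h. Both claims follow from
one estimate, `exists_wienerNorm_exp_mul_le`: for λ ≥ λ₀ and 0 < ε < 1, the Wiener norm of e^{λφ}h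
is at most a constant times ‖h‖ e^{−λMε²/4} + ε^{r+1} β_{r+1}(ε) ((√λ + 1/ε)/√λ)^{d/2}.

The Wiener norm is controlled by a Sobolev inequality of order K > d/2 at a free frequency scale a
(`exists_sobolev`). If a function is bounded by B e^{−κ|ξ|²} and its derivatives of order K by B a^K
e^{−κ|ξ|²}, its norm is at most a constant times B (a/√κ)^{d/2}
(`exists_wienerNorm_le_of_gaussian`). Applied directly to e^{λφ} this is wasteful, because the drift
oscillates at a frequency of order λ. But multiplication by a character does not change the norm, so
the integer vector nearest to λm can be removed. What remains, W, oscillates at scale 1 + √λ under a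
Gaussian of width 1/√λ (`exists_derivBound_exp_phase`), so its norm is bounded. The Gaussian decay
requires M > 0 (`decayM_pos`), where infinite divisibility and minimality of the lattice enter.

A smooth periodic cutoff k at radius ε then splits hW = h·(1 − k)W + kWh. In the first term
submultiplicativity leaves ‖h‖ times the norm of (1 − k)W, which is exponentially small. In the
second, Taylor's formula makes h and its derivatives of size ε^{r+1} β_{r+1}(ε) at frequency 1/ε
(`derivBound_of_taylor`).

Claim (1) is a weakening of this estimate. Claim (2) takes for ε the radius κ log λ/√λ: for κ large
the exponential beats the required power of λ, while the Taylor term gives the rate. -/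

noncomputable section

namespace MultiWiener

/-! ### Fourier series on the torus and the Wiener algebra -/

section Torus

variable {d : ℕ}

/-- Normalised Haar measure on the circle, as used by Mathlib for Fourier series on the torus. -/
abbrev haarCircle : MeasureSpace UnitAddCircle := ⟨AddCircle.haarAddCircle⟩

attribute [local instance] haarCircle

local instance : IsProbabilityMeasure (volume : Measure UnitAddCircle) :=
  inferInstanceAs (IsProbabilityMeasure AddCircle.haarAddCircle)

/-- Invariance under the whole period lattice, for functions with arbitrary values. -/
def LatticePeriodic {α : Type*} (f : (Fin d → ℝ) → α) : Prop :=
  ∀ (ξ : Fin d → ℝ) (m : Fin d → ℤ), f (fun i => ξ i + 2 * Real.pi * m i) = f ξ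

theorem TorusPeriodic.latticePeriodic {f : (Fin d → ℝ) → ℂ} (hf : TorusPeriodic f) :
    LatticePeriodic f := by
  intro ξ m
  have h1 : ∀ s : Finset (Fin d), Function.Periodic f
      (∑ i ∈ s, m i • (Pi.single i (2 * Real.pi) : Fin d → ℝ)) := by
    intro s
    induction s using Finset.induction_on with
    | empty => intro x; simp
    | insert a s ha ih =>
      rw [Finset.sum_insert ha]
      exact Function.Periodic.add_period (Function.Periodic.zsmul (fun x => hf x a) _) ih
  have h2 := h1 Finset.univ ξ
  rw [← h2]
  congr 1
  ext i
  simp [Finset.sum_apply, Pi.single_apply, mul_comm]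

/-- The function on `(ℝ / ℤ)^d` induced by a lattice periodic function. -/
def torusLift {α : Type*} (f : (Fin d → ℝ) → α) (x : UnitAddTorus (Fin d)) : α :=
  f fun i => 2 * Real.pi * (AddCircle.equivIoc 1 0 (x i) : ℝ)

theorem torusLift_coe {α : Type*} {f : (Fin d → ℝ) → α} (hf : LatticePeriodic f)
    (y : Fin d → ℝ) :
    torusLift f (fun i => (y i : UnitAddCircle)) = f fun i => 2 * Real.pi * y i := by
  have : ∀ i, ∃ m : ℤ, (AddCircle.equivIoc 1 0 (y i : UnitAddCircle) : ℝ) = y i + m := by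
    intro i
    have h := (AddCircle.equivIoc (1 : ℝ) 0).symm_apply_apply (y i : UnitAddCircle)
    have h' : (((AddCircle.equivIoc (1 : ℝ) 0 (y i : UnitAddCircle) : ℝ)) : UnitAddCircle)
        = (y i : UnitAddCircle) := h
    rw [← sub_eq_zero, ← AddCircle.coe_sub, AddCircle.coe_eq_zero_iff] at h'
    obtain ⟨m, hm⟩ := h'
    exact ⟨m, by simp only [zsmul_eq_mul, mul_one] at hm; rw [hm]; ring⟩
  choose m hm using this
  have h := hf (fun i => 2 * Real.pi * y i) m
  rw [← h, torusLift]
  congr 1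
  ext i
  rw [hm i]; ring

theorem continuous_torusLift {α : Type*} [TopologicalSpace α] {f : (Fin d → ℝ) → α}
    (hf : LatticePeriodic f) (hc : Continuous f) : Continuous (torusLift f) := by
  have hq : IsOpenQuotientMap (fun (y : Fin d → ℝ) (i : Fin d) => (y i : UnitAddCircle)) :=
    IsOpenQuotientMap.piMap fun _ => QuotientAddGroup.isOpenQuotientMap_mk
  rw [hq.isQuotientMap.continuous_iff]
  have : torusLift f ∘ (fun (y : Fin d → ℝ) (i : Fin d) => (y i : UnitAddCircle)) =
      fun y => f fun i => 2 * Real.pi * y i := funext fun y => torusLift_coe hf y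
  rw [this]
  fun_prop

/-- Integrals of periodic functions may be computed over any cube of side `2π`. -/
theorem integral_torusLift {E : Type*} [NormedAddCommGroup E] [NormedSpace ℝ E]
    {g : (Fin d → ℝ) → E} (hg : LatticePeriodic g) (a : ℝ) :
    ∫ x, torusLift g x = ((2 * Real.pi) ^ d)⁻¹ •
      ∫ θ in Set.Icc (fun _ : Fin d => a) (fun _ => a + 2 * Real.pi), g θ := by
  rw [UnitAddTorus.integral_preimage _ (fun _ => a / (2 * Real.pi))]
  have hpi := Real.pi_pos
  simp_rw [torusLift_coe hg]
  have h1 := Measure.setIntegral_comp_smul_of_pos (volume : Measure (Fin d → ℝ)) g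
    {x : Fin d → ℝ | ∀ i, x i ∈ Set.Ioc (a / (2 * Real.pi)) (a / (2 * Real.pi) + 1)}
    (R := 2 * Real.pi) (by positivity)
  simp only [Module.finrank_fintype_fun_eq_card, Fintype.card_fin] at h1
  refine Eq.trans (h1.trans ?_) rfl
  congr 1
  rw [volume_pi, ← setIntegral_congr_set Measure.univ_pi_Ioc_ae_eq_Icc]
  congr 2
  ext x
  rw [Set.mem_smul_set_iff_inv_smul_mem₀ (by positivity)]
  simp only [Set.mem_ofPred_eq, Pi.smul_apply, smul_eq_mul, Set.mem_pi, Set.mem_univ, true_implies,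
    Set.mem_Ioc]
  refine forall_congr' fun i => ?_
  rw [inv_mul_eq_div, div_lt_div_iff_of_pos_right (by positivity),
    div_add_one (by positivity), div_le_div_iff_of_pos_right (by positivity)]

/-- The character `ξ ↦ exp(i⟨n,ξ⟩)`. -/
def character (n : Fin d → ℤ) (ξ : Fin d → ℝ) : ℂ :=
  Complex.exp (Complex.I * ∑ j, (n j : ℂ) * (ξ j : ℂ))

theorem character_neg (n : Fin d → ℤ) (ξ : Fin d → ℝ) :
    character (-n) ξ = Complex.exp (-(Complex.I * ∑ j, (n j : ℂ) * (ξ j : ℂ))) := by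
  simp [character]

theorem character_add (m n : Fin d → ℤ) (ξ : Fin d → ℝ) :
    character (m + n) ξ = character m ξ * character n ξ := by
  simp [character, ← Complex.exp_add, add_mul, Finset.sum_add_distrib, mul_add]

theorem norm_character (n : Fin d → ℤ) (ξ : Fin d → ℝ) : ‖character n ξ‖ = 1 := by
  have : character n ξ = Complex.exp (((∑ j, (n j : ℝ) * ξ j : ℝ) : ℂ) * Complex.I) := by
    rw [character, mul_comm]; push_cast; rfl
  rw [this, Complex.norm_exp_ofReal_mul_I]

theorem contDiff_character (n : Fin d → ℤ) (N : WithTop ℕ∞) : ContDiff ℝ N (character n) := by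
  unfold character
  refine ContDiff.cexp (contDiff_const.mul (ContDiff.sum fun j _ => contDiff_const.mul ?_))
  exact Complex.ofRealCLM.contDiff.comp (contDiff_apply ℝ ℝ j)

theorem torusPeriodic_character (n : Fin d → ℤ) : TorusPeriodic (character n) := by
  intro ξ i
  have : Complex.I * ∑ j, (n j : ℂ) * (((ξ + Pi.single i (2 * Real.pi) : Fin d → ℝ) j : ℝ) : ℂ) =
      Complex.I * ∑ j, (n j : ℂ) * (ξ j : ℂ) + n i * (2 * Real.pi * Complex.I) := by
    have h : ∀ j, (n j : ℂ) * (((ξ + Pi.single i (2 * Real.pi) : Fin d → ℝ) j : ℝ) : ℂ) =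
        (n j : ℂ) * (ξ j : ℂ) + if j = i then (n j : ℂ) * (2 * Real.pi) else 0 := by
      intro j
      by_cases hj : j = i
      · subst hj; simp; ring
      · simp [hj]
    simp_rw [h, Finset.sum_add_distrib]
    simp; ring
  rw [character, this, Complex.exp_add, Complex.exp_int_mul_two_pi_mul_I, mul_one, character]

theorem mFourier_coe (n : Fin d → ℤ) (y : Fin d → ℝ) :
    UnitAddTorus.mFourier n (fun i => (y i : UnitAddCircle)) =
      character n fun i => 2 * Real.pi * y i := by
  simp only [UnitAddTorus.mFourier, ContinuousMap.coe_mk, fourier_coe_apply, character,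
    ← Complex.exp_sum, Finset.mul_sum]
  congr 1
  refine Finset.sum_congr rfl fun j _ => ?_
  push_cast; ring

theorem TorusPeriodic.mul {f g : (Fin d → ℝ) → ℂ} (hf : TorusPeriodic f) (hg : TorusPeriodic g) :
    TorusPeriodic (f * g) := fun ξ i => by simp [hf ξ i, hg ξ i]

theorem TorusPeriodic.sub {f g : (Fin d → ℝ) → ℂ} (hf : TorusPeriodic f) (hg : TorusPeriodic g) :
    TorusPeriodic (f - g) := fun ξ i => by simp [hf ξ i, hg ξ i]

theorem LatticePeriodic.comp {α β : Type*} {f : (Fin d → ℝ) → α} (hf : LatticePeriodic f)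
    (g : α → β) : LatticePeriodic fun ξ => g (f ξ) := fun ξ m => congrArg g (hf ξ m)

/-- Rescaling by 2π turns the monomials on (ℝ/ℤ)^d into characters, and its Jacobian is the factor
(2π)^{-d}. Parseval and inversion are imported through this identity. -/
theorem fourierCoeff_eq_mFourierCoeff {f : (Fin d → ℝ) → ℂ} (hf : TorusPeriodic f)
    (n : Fin d → ℤ) : fourierCoeff f n = UnitAddTorus.mFourierCoeff (torusLift f) n := by
  have h : ∀ x : UnitAddTorus (Fin d), UnitAddTorus.mFourier (-n) x • torusLift f x =
      torusLift (f * character (-n)) x := by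
    intro x
    obtain ⟨y, rfl⟩ : ∃ y : Fin d → ℝ, (fun i => (y i : UnitAddCircle)) = x := by
      choose y hy using fun i => QuotientAddGroup.mk_surjective (x i)
      exact ⟨y, funext hy⟩
    rw [mFourier_coe, torusLift_coe hf.latticePeriodic,
      torusLift_coe (hf.mul (torusPeriodic_character _)).latticePeriodic]
    simp [mul_comm]
  have hz := integral_torusLift (hf.mul (torusPeriodic_character (-n))).latticePeriodic 0
  simp only [zero_add] at hz
  rw [UnitAddTorus.mFourierCoeff]
  simp_rw [h]
  rw [hz, fourierCoeff, Complex.real_smul]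
  congr 1
  · push_cast; rw [one_div]
  · simp only [Pi.mul_apply, character_neg]; rfl

/-- The lift of a continuous periodic function as a continuous map on the torus. -/
def torusMap {f : (Fin d → ℝ) → ℂ} (hf : TorusPeriodic f) (hc : Continuous f) :
    C(UnitAddTorus (Fin d), ℂ) := ⟨torusLift f, continuous_torusLift hf.latticePeriodic hc⟩

/-- Parseval's identity, with the cube `[-π,π]^d` as a fundamental domain. -/
theorem hasSum_sq_fourierCoeff {f : (Fin d → ℝ) → ℂ} (hf : TorusPeriodic f) (hc : Continuous f) :
    HasSum (fun n => ‖fourierCoeff f n‖ ^ 2) (((2 * Real.pi) ^ d)⁻¹ *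
      ∫ θ in Set.Icc (fun _ : Fin d => -Real.pi) (fun _ => Real.pi), ‖f θ‖ ^ 2) := by
  have h := UnitAddTorus.hasSum_sq_mFourierCoeff
    (ContinuousMap.toLp (E := ℂ) 2 volume ℂ (torusMap hf hc))
  simp_rw [UnitAddTorus.mFourierCoeff_toLp] at h
  have h1 : ∫ t, ‖(ContinuousMap.toLp (E := ℂ) 2 volume ℂ (torusMap hf hc)) t‖ ^ 2 =
      ∫ t, torusLift (fun θ => ‖f θ‖ ^ 2) t := by
    refine integral_congr_ae ?_
    filter_upwards [ContinuousMap.coeFn_toLp (p := 2) (𝕜 := ℂ) volume (torusMap hf hc)] with t ht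
    rw [ht]; rfl
  rw [h1, integral_torusLift (hf.latticePeriodic.comp fun z => ‖z‖ ^ 2) (-Real.pi)] at h
  have h2 : -Real.pi + 2 * Real.pi = Real.pi := by ring
  rw [h2, smul_eq_mul] at h
  simp_rw [fourierCoeff_eq_mFourierCoeff hf]
  exact h

/-- Fourier inversion in the Wiener algebra. -/
theorem MemWiener.hasSum_character {f : (Fin d → ℝ) → ℂ} (hf : MemWiener f) (ξ : Fin d → ℝ) :
    HasSum (fun n => fourierCoeff f n * character n ξ) (f ξ) := by
  have hs : Summable (UnitAddTorus.mFourierCoeff (torusMap hf.periodic hf.continuous)) := by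
    refine Summable.of_norm ?_
    refine hf.summable.congr fun n => ?_
    rw [fourierCoeff_eq_mFourierCoeff hf.periodic]; rfl
  have hpi := Real.pi_pos
  have h := UnitAddTorus.hasSum_mFourier_series_apply_of_summable hs
    (fun i => ((ξ i / (2 * Real.pi) : ℝ) : UnitAddCircle))
  have h2 : (fun i => 2 * Real.pi * (ξ i / (2 * Real.pi))) = ξ := by
    ext i; field_simp
  have h3 : torusMap hf.periodic hf.continuous
      (fun i => ((ξ i / (2 * Real.pi) : ℝ) : UnitAddCircle)) = f ξ := by
    have := torusLift_coe hf.periodic.latticePeriodic (fun i => ξ i / (2 * Real.pi))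
    rw [h2] at this
    exact this
  rw [h3] at h
  refine h.congr_fun fun n => ?_
  rw [mFourier_coe, h2, fourierCoeff_eq_mFourierCoeff hf.periodic, smul_eq_mul]
  rfl

theorem fourierCoeff_mul_character (f : (Fin d → ℝ) → ℂ) (m n : Fin d → ℤ) :
    fourierCoeff (f * character m) n = fourierCoeff f (n - m) := by
  simp only [fourierCoeff, ← character_neg, Pi.mul_apply]
  congr 2
  ext θ
  rw [show -(n - m) = m + -n by ring, character_add, mul_assoc]

/-- Multiplication by a character only translates the Fourier coefficients. This invariance is what
permits removing an integral drift from e^{λφ}. -/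
theorem wienerNorm_mul_character (f : (Fin d → ℝ) → ℂ) (m : Fin d → ℤ) :
    wienerNorm (f * character m) = wienerNorm f := by
  simp only [wienerNorm, fourierCoeff_mul_character]
  exact (Equiv.subRight m).tsum_eq (fun n => ‖fourierCoeff f n‖)

/-- The absolutely convergent series of `f` is inserted into the integral and integrated term by
term, so `g` need only be continuous. -/
theorem hasSum_fourierCoeff_mul {f g : (Fin d → ℝ) → ℂ} (hf : MemWiener f) (hg : Continuous g)
    (m : Fin d → ℤ) : HasSum (fun n => fourierCoeff f n * fourierCoeff g (m - n))
      (fourierCoeff (f * g) m) := by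
  have hG : ∀ n, fourierCoeff f n * fourierCoeff g (m - n) = (1 / (2 * (Real.pi : ℂ)) ^ d) *
      ∫ θ in Set.Icc (0 : Fin d → ℝ) (fun _ => 2 * Real.pi),
        (fourierCoeff f n * character n θ) * (g θ * character (-m) θ) := by
    intro n
    rw [← fourierCoeff_mul_character g n m]
    simp only [fourierCoeff, ← character_neg, Pi.mul_apply]
    rw [mul_left_comm, ← integral_const_mul]
    congr 2
    ext θ
    ring
  simp_rw [hG]
  have hF : fourierCoeff (f * g) m = (1 / (2 * (Real.pi : ℂ)) ^ d) *
      ∫ θ in Set.Icc (0 : Fin d → ℝ) (fun _ => 2 * Real.pi),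
        ∑' n, (fourierCoeff f n * character n θ) * (g θ * character (-m) θ) := by
    simp only [tsum_mul_right, (hf.hasSum_character _).tsum_eq]
    simp only [fourierCoeff, ← character_neg, Pi.mul_apply, mul_assoc]
  rw [hF]
  refine HasSum.mul_left _ (hasSum_integral_of_summable_integral_norm ?_ ?_)
  · intro n
    refine ContinuousOn.integrableOn_compact isCompact_Icc (Continuous.continuousOn ?_)
    have h1 := (contDiff_character (d := d) n 0).continuous
    have h2 := (contDiff_character (d := d) (-m) 0).continuous
    fun_prop
  · refine Summable.of_nonneg_of_le (fun n => integral_nonneg fun _ => norm_nonneg _)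
      (fun n => ?_) (hf.summable.mul_right (∫ θ in Set.Icc (0 : Fin d → ℝ)
        (fun _ => 2 * Real.pi), ‖g θ‖))
    simp only [norm_mul, norm_character, mul_one]
    rw [integral_const_mul]

/-- The Wiener norm is submultiplicative. -/
theorem wienerNorm_mul_le {f g : (Fin d → ℝ) → ℂ} (hf : MemWiener f) (hg : MemWiener g) :
    wienerNorm (f * g) ≤ wienerNorm f * wienerNorm g := by
  have hs : Summable fun p : (Fin d → ℤ) × (Fin d → ℤ) =>
      ‖fourierCoeff f p.1‖ * ‖fourierCoeff g p.2‖ :=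
    hf.summable.mul_of_nonneg hg.summable (fun _ => norm_nonneg _) fun _ => norm_nonneg _
  -- The shear (m, n) ↦ (n, m − n) turns the double sum of the convolution into a product of two
  -- sums.
  let e : (Fin d → ℤ) × (Fin d → ℤ) ≃ (Fin d → ℤ) × (Fin d → ℤ) :=
    { toFun := fun p => (p.2, p.1 - p.2)
      invFun := fun p => (p.1 + p.2, p.1)
      left_inv := fun p => by simp
      right_inv := fun p => by simp }
  have hs' : Summable fun p : (Fin d → ℤ) × (Fin d → ℤ) =>
      ‖fourierCoeff f p.2‖ * ‖fourierCoeff g (p.1 - p.2)‖ := e.summable_iff.2 hs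
  have hle : ∀ m, ‖fourierCoeff (f * g) m‖ ≤
      ∑' n, ‖fourierCoeff f n‖ * ‖fourierCoeff g (m - n)‖ := by
    intro m
    rw [← (hasSum_fourierCoeff_mul hf hg.continuous m).tsum_eq]
    simp_rw [← norm_mul]
    refine norm_tsum_le_tsum_norm ?_
    simpa using hs'.prod_factor m
  have hsum : Summable fun m => ∑' n, ‖fourierCoeff f n‖ * ‖fourierCoeff g (m - n)‖ := hs'.prod
  calc wienerNorm (f * g) ≤ ∑' m, ∑' n, ‖fourierCoeff f n‖ * ‖fourierCoeff g (m - n)‖ :=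
        Summable.tsum_le_tsum hle
          (Summable.of_nonneg_of_le (fun _ => norm_nonneg _) hle hsum) hsum
    _ = ∑' p : (Fin d → ℤ) × (Fin d → ℤ), ‖fourierCoeff f p.2‖ * ‖fourierCoeff g (p.1 - p.2)‖ :=
        (hs'.tsum_prod).symm
    _ = ∑' p : (Fin d → ℤ) × (Fin d → ℤ), ‖fourierCoeff f p.1‖ * ‖fourierCoeff g p.2‖ :=
        e.tsum_eq fun p => ‖fourierCoeff f p.1‖ * ‖fourierCoeff g p.2‖
    _ = wienerNorm f * wienerNorm g := by
        rw [wienerNorm, wienerNorm, hf.summable.tsum_mul_tsum hg.summable hs]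

end Torus

/-! ### Derivatives of periodic functions and their Fourier coefficients -/

section Sobolev

variable {d : ℕ}

/-- The derivative of `f` in the `i`-th coordinate direction. -/
def dirDeriv (i : Fin d) (f : (Fin d → ℝ) → ℂ) (ξ : Fin d → ℝ) : ℂ :=
  fderiv ℝ f ξ (Pi.single i 1)

theorem TorusPeriodic.dirDeriv {f : (Fin d → ℝ) → ℂ} (hf : TorusPeriodic f) (i : Fin d) :
    TorusPeriodic (dirDeriv i f) := by
  intro ξ j
  have h : (fun x => f (x + Pi.single j (2 * Real.pi))) = f := funext fun x => hf x j
  have h2 := fderiv_comp_add_right (𝕜 := ℝ) (f := f) (x := ξ) (Pi.single j (2 * Real.pi))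
  rw [h] at h2
  rw [MultiWiener.dirDeriv, MultiWiener.dirDeriv, h2]

theorem contDiff_dirDeriv {f : (Fin d → ℝ) → ℂ} {n : ℕ}
    (hf : ContDiff ℝ ((n + 1 : ℕ) : WithTop ℕ∞) f) (i : Fin d) :
    ContDiff ℝ (n : WithTop ℕ∞) (dirDeriv i f) :=
  (hf.fderiv_right (m := (n : WithTop ℕ∞)) (by norm_cast)).clm_apply contDiff_const

/-- The integral of a derivative of a periodic function over a period vanishes. -/
theorem integral_dirDeriv {f : (Fin d → ℝ) → ℂ} (hf : TorusPeriodic f) (hc : ContDiff ℝ 1 f)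
    (i : Fin d) : ∫ θ in Set.Icc (0 : Fin d → ℝ) (fun _ => 2 * Real.pi), dirDeriv i f θ = 0 := by
  obtain _ | d := d
  · exact i.elim0
  have hpi := Real.pi_pos
  have hD : Continuous (dirDeriv i f) := (contDiff_dirDeriv (n := 0) (by simpa using hc) i).continuous
  have key : ∀ x : Fin (d + 1) → ℝ, ∑ j, (if j = i then fderiv ℝ f x else 0) (Pi.single j (1 : ℝ)) =
      dirDeriv i f x := by
    intro x
    rw [Finset.sum_eq_single i]
    · simp [dirDeriv]
    · intro j _ hj; simp [hj]
    · simp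
  -- Divergence theorem for the vector field whose only nonzero component is `f` in direction `i`;
  -- the two opposite faces cancel by periodicity.
  have h := integral_divergence_of_hasFDerivAt_off_countable' (0 : Fin (d + 1) → ℝ)
    (fun _ => 2 * Real.pi) (fun _ => by simp; positivity)
    (fun j => if j = i then f else 0) (fun j x => if j = i then fderiv ℝ f x else 0) ∅
    Set.countable_empty ?_ ?_ ?_
  · simp_rw [key] at h
    rw [h]
    refine Finset.sum_eq_zero fun j _ => ?_
    by_cases hj : j = i
    · simp only [hj, if_true]
      rw [sub_eq_zero]
      congr 1
      ext x
      have h2 := hf (i.insertNth 0 x) i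
      rw [Pi.zero_apply, ← h2]
      congr 1
      ext k
      refine Fin.succAboveCases i ?_ (fun k => ?_) k
      · simp
      · simp [Fin.succAbove_ne]
    · simp [hj]
  · intro j
    by_cases hj : j = i
    · simpa [hj] using hc.continuous.continuousOn
    · simp only [hj, if_false]; exact continuousOn_const
  · intro x _ j
    by_cases hj : j = i
    · simpa [hj] using (hc.differentiable one_ne_zero x).hasFDerivAt
    · simp only [hj, if_false]; exact hasFDerivAt_const _ _
  · simp_rw [key]
    exact hD.continuousOn.integrableOn_compact isCompact_Icc

theorem dirDeriv_character (n : Fin d → ℤ) (i : Fin d) (ξ : Fin d → ℝ) :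
    dirDeriv i (character n) ξ = Complex.I * n i * character n ξ := by
  have h : HasFDerivAt (character n) (character n ξ • (Complex.I • ∑ j, (n j : ℂ) •
      (Complex.ofRealCLM.comp (ContinuousLinearMap.proj (R := ℝ) (φ := fun _ : Fin d => ℝ) j)))) ξ := by
    refine HasFDerivAt.cexp (HasFDerivAt.const_mul (HasFDerivAt.fun_sum fun j _ => ?_) _)
    refine HasFDerivAt.const_mul ?_ _
    exact (Complex.ofRealCLM.comp
      (ContinuousLinearMap.proj (R := ℝ) (φ := fun _ : Fin d => ℝ) j)).hasFDerivAt
  rw [dirDeriv, h.fderiv]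
  simp [Pi.single_apply, apply_ite Complex.ofReal]
  ring

/-- Integration by parts: the derivative of `f * character (-n)` has integral zero over a period. -/
theorem fourierCoeff_dirDeriv {f : (Fin d → ℝ) → ℂ} (hf : TorusPeriodic f) (hc : ContDiff ℝ 1 f)
    (i : Fin d) (n : Fin d → ℤ) :
    fourierCoeff (dirDeriv i f) n = Complex.I * n i * fourierCoeff f n := by
  have hch := contDiff_character (d := d) (-n) 1
  have h := integral_dirDeriv (hf.mul (torusPeriodic_character (-n))) (hc.mul hch) i
  have hD : Continuous (dirDeriv i f) := (contDiff_dirDeriv (n := 0) (by simpa using hc) i).continuous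
  have h2 : ∀ θ, dirDeriv i (f * character (-n)) θ =
      dirDeriv i f θ * character (-n) θ - Complex.I * n i * (f θ * character (-n) θ) := by
    intro θ
    have h3 := dirDeriv_character (-n) i θ
    rw [dirDeriv] at h3
    rw [dirDeriv, fderiv_mul (hc.differentiable one_ne_zero θ) (hch.differentiable one_ne_zero θ)]
    simp only [add_apply, smul_apply, smul_eq_mul, h3,
      dirDeriv]
    simp
    ring
  simp_rw [h2] at h
  rw [integral_sub, integral_const_mul, sub_eq_zero] at h
  · simp only [fourierCoeff, ← character_neg]
    rw [h]; ring
  · exact (hD.mul hch.continuous).continuousOn.integrableOn_compact isCompact_Icc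
  · exact (continuous_const.mul (hc.continuous.mul hch.continuous)).continuousOn.integrableOn_compact
      isCompact_Icc

/-- One induction carries all four facts, since each new derivative needs the periodicity and
smoothness left by the previous ones. `N` counts the derivatives still available. -/
theorem iterate_dirDeriv {f : (Fin d → ℝ) → ℂ} (hf : TorusPeriodic f) (i : Fin d) (N k : ℕ)
    (hc : ContDiff ℝ ((N + k : ℕ) : WithTop ℕ∞) f) :
    TorusPeriodic ((dirDeriv i)^[k] f) ∧ ContDiff ℝ (N : WithTop ℕ∞) ((dirDeriv i)^[k] f) ∧
      (∀ n, fourierCoeff ((dirDeriv i)^[k] f) n = (Complex.I * n i) ^ k * fourierCoeff f n) ∧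
      ∀ ξ, (dirDeriv i)^[k] f ξ = iteratedFDeriv ℝ k f ξ fun _ => Pi.single i 1 := by
  induction k generalizing N with
  | zero => exact ⟨hf, by simpa using hc, by simp, by simp⟩
  | succ k ih =>
    obtain ⟨h1, h2, h3, h4⟩ := ih (N + 1) (by convert hc using 2; ring)
    rw [Function.iterate_succ_apply']
    refine ⟨h1.dirDeriv i, contDiff_dirDeriv h2 i, fun n => ?_, fun ξ => ?_⟩
    · rw [fourierCoeff_dirDeriv h1 (h2.of_le (by norm_cast; omega)), h3]; ring
    · have h5 : (dirDeriv i)^[k] f = fun ξ => iteratedFDeriv ℝ k f ξ fun _ => Pi.single i 1 :=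
        funext h4
      have h6 : DifferentiableAt ℝ (iteratedFDeriv ℝ k f) ξ :=
        (hc.differentiable_iteratedFDeriv (by norm_cast; omega)) ξ
      rw [iteratedFDeriv_succ_apply_left, h5, dirDeriv]
      have h7 := (ContinuousMultilinearMap.apply ℝ (fun _ : Fin k => Fin d → ℝ) ℂ
        (fun _ => Pi.single i 1)).hasFDerivAt.comp ξ h6.hasFDerivAt
      exact congrArg (fun L => L (Pi.single i (1 : ℝ))) h7.fderiv

end Sobolev

/-! ### Sobolev embedding into the Wiener algebra, and Gaussian bounds -/

section SobolevEmbedding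

variable {d : ℕ}

theorem summable_inv_one_add_norm_pow {p : ℕ} (hp : d < p) :
    Summable fun q : Fin d → ℤ => ((1 + ‖q‖) ^ p)⁻¹ := by
  let L := Submodule.span ℤ (Set.range (Pi.basisFun ℝ (Fin d)))
  have hr : Module.finrank ℤ L = d := by
    rw [ZLattice.rank ℝ L]; simp
  have hs := ZLattice.summable_norm_pow_inv L p (by rw [hr]; exact hp)
  have hmem : ∀ q : Fin d → ℤ, (fun i => (q i : ℝ)) ∈ L := by
    intro q
    have : (fun i => (q i : ℝ)) = ∑ i, q i • Pi.basisFun ℝ (Fin d) i := by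
      ext j; simp [Finset.sum_apply, Pi.single_apply]
    rw [this]
    exact Submodule.sum_mem _ fun i _ => Submodule.smul_mem _ _
      (Submodule.subset_span (Set.mem_range_self i))
  let j : (Fin d → ℤ) → L := fun q => ⟨fun i => (q i : ℝ), hmem q⟩
  have hj : Function.Injective j := by
    intro q q' h
    ext i
    have := congrFun (congrArg Subtype.val h) i
    exact Int.cast_injective (α := ℝ) this
  have hs2 := hs.comp_injective hj
  have hn : ∀ q, ‖j q‖ = ‖q‖ := by
    intro q
    change ‖(fun i => (q i : ℝ))‖ = ‖q‖
    simp only [Pi.norm_def]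
    congr 2
  -- At the origin the inverse of the norm has the default value 0, so the missing term 1 is added
  -- by hand.
  have hs3 : Summable fun q : Fin d → ℤ => ‖q‖⁻¹ ^ p + if q = 0 then 1 else 0 := by
    refine Summable.add (hs2.congr fun q => by rw [Function.comp_apply, hn]) ?_
    exact (hasSum_ite_eq (0 : Fin d → ℤ) (1 : ℝ)).summable
  refine Summable.of_nonneg_of_le (fun q => by positivity) (fun q => ?_) hs3
  by_cases hq : q = 0
  · subst hq
    simp only [norm_zero, add_zero, one_pow, inv_one, if_true, inv_zero]
    have : (0 : ℝ) ≤ 0 ^ p := by positivity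
    linarith
  · have : 0 < ‖q‖ := norm_pos_iff.2 hq
    simp only [hq, if_false, add_zero, inv_pow]
    gcongr
    linarith

/-- The lattice sum `∑ (a + ‖n‖)^{-p}` is of order `a^{d-p}` for `a ≥ 1`. -/
theorem exists_tsum_inv_add_norm_pow_le {p : ℕ} (hp : d < p) :
    ∃ C : ℝ, 0 ≤ C ∧ ∀ a : ℝ, 1 ≤ a →
      Summable (fun n : Fin d → ℤ => ((a + ‖n‖) ^ p)⁻¹) ∧
      ∑' n : Fin d → ℤ, ((a + ‖n‖) ^ p)⁻¹ ≤ C * (a ^ d * (a ^ p)⁻¹) := by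
  have hS := summable_inv_one_add_norm_pow hp
  refine ⟨4 ^ p * ∑' q : Fin d → ℤ, ((1 + ‖q‖) ^ p)⁻¹,
    mul_nonneg (by positivity) (tsum_nonneg fun q => by positivity), fun a ha => ?_⟩
  -- Euclidean division n = Aq + s of each coordinate by A = ⌊a⌋. Each of the A^d residues s
  -- contributes a sum of order a^{-p}. The constant 4 comes from a ≤ 2A.
  set A := ⌊a⌋₊ with hA
  have hA1 : 1 ≤ A := by rw [hA]; exact (Nat.one_le_floor_iff a).2 ha
  have hAa : (A : ℝ) ≤ a := Nat.floor_le (by linarith)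
  have hAa2 : a < A + 1 := Nat.lt_floor_add_one a
  have hA1' : (1 : ℝ) ≤ A := by exact_mod_cast hA1
  have : NeZero A := ⟨by omega⟩
  let e : (Fin d → ℤ) ≃ (Fin d → ℤ) × (Fin d → Fin A) :=
    (Equiv.piCongrRight fun _ => Int.divModEquiv A).trans (Equiv.arrowProdEquivProdArrow _ _ _)
  have he : ∀ q s i, e.symm (q, s) i = q i * A + ((s i : ℕ) : ℤ) := fun q s i => rfl
  have hle : ∀ q s, ((a + ‖e.symm (q, s)‖) ^ p)⁻¹ ≤ (4 / a) ^ p * ((1 + ‖q‖) ^ p)⁻¹ * 1 := by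
    intro q s
    have h1 : A * ‖q‖ ≤ ‖e.symm (q, s)‖ + A := by
      have h2 : ‖q‖ ≤ (‖e.symm (q, s)‖ + A) / A := by
        refine (pi_norm_le_iff_of_nonneg (by positivity)).2 fun i => ?_
        rw [le_div_iff₀ (by linarith)]
        have h3 := norm_le_pi_norm (e.symm (q, s)) i
        rw [he] at h3
        have h4 : ((s i : ℕ) : ℝ) ≤ A := by exact_mod_cast (s i).2.le
        simp only [Int.norm_eq_abs] at h3 ⊢
        push_cast at h3
        calc |(q i : ℝ)| * A = |(q i * A + (s i : ℕ) : ℝ) - (s i : ℕ)| := by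
              rw [add_sub_cancel_right, abs_mul, Nat.abs_cast]
          _ ≤ |(q i * A + (s i : ℕ) : ℝ)| + |((s i : ℕ) : ℝ)| := abs_sub _ _
          _ ≤ _ := by rw [Nat.abs_cast]; linarith
      rw [le_div_iff₀ (by linarith)] at h2
      linarith
    have h5 : a / 4 * (1 + ‖q‖) ≤ a + ‖e.symm (q, s)‖ := by
      have : a ≤ 2 * A := by linarith
      nlinarith [norm_nonneg q, norm_nonneg (e.symm (q, s))]
    have h6 : (4 / a) ^ p * ((1 + ‖q‖) ^ p)⁻¹ = ((a / 4 * (1 + ‖q‖)) ^ p)⁻¹ := by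
      rw [mul_pow, mul_inv, ← inv_pow (a / 4), inv_div]
    rw [mul_one, h6]
    gcongr
  have hSA : Summable fun _ : Fin d → Fin A => (1 : ℝ) := Summable.of_finite
  have hSq := hS.mul_left ((4 / a) ^ p)
  have hprod := hSq.mul_of_nonneg hSA (fun q => by positivity) fun _ => zero_le_one
  have hsum : Summable fun x : (Fin d → ℤ) × (Fin d → Fin A) => ((a + ‖e.symm x‖) ^ p)⁻¹ :=
    Summable.of_nonneg_of_le (fun x => by positivity) (fun x => hle x.1 x.2) hprod
  refine ⟨e.symm.summable_iff.1 hsum, ?_⟩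
  rw [← e.symm.tsum_eq]
  calc ∑' x, ((a + ‖e.symm x‖) ^ p)⁻¹
      ≤ ∑' x : (Fin d → ℤ) × (Fin d → Fin A), (4 / a) ^ p * ((1 + ‖x.1‖) ^ p)⁻¹ * 1 :=
        Summable.tsum_le_tsum (fun x => hle x.1 x.2) hsum hprod
    _ = (∑' q : Fin d → ℤ, (4 / a) ^ p * ((1 + ‖q‖) ^ p)⁻¹) * ∑' _ : Fin d → Fin A, (1 : ℝ) :=
        (hSq.tsum_mul_tsum hSA hprod).symm
    _ = (4 / a) ^ p * (∑' q : Fin d → ℤ, ((1 + ‖q‖) ^ p)⁻¹) * A ^ d := by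
        rw [tsum_mul_left]; simp
    _ ≤ (4 / a) ^ p * (∑' q : Fin d → ℤ, ((1 + ‖q‖) ^ p)⁻¹) * a ^ d := by
        have : 0 ≤ ∑' q : Fin d → ℤ, ((1 + ‖q‖) ^ p)⁻¹ := tsum_nonneg fun q => by positivity
        gcongr
    _ = _ := by rw [div_pow]; ring

theorem summable_mul_and_sq_tsum_le {ι : Type*} {f g : ι → ℝ} (hf : ∀ i, 0 ≤ f i)
    (hg : ∀ i, 0 ≤ g i) (hfs : Summable fun i => f i ^ 2) (hgs : Summable fun i => g i ^ 2) :
    (Summable fun i => f i * g i) ∧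
      (∑' i, f i * g i) ^ 2 ≤ (∑' i, f i ^ 2) * ∑' i, g i ^ 2 := by
  have h := Real.summable_and_inner_le_Lp_mul_Lq_tsum_of_nonneg (p := 2) (q := 2)
    Real.HolderConjugate.two_two hf hg (by simpa using hfs) (by simpa using hgs)
  refine ⟨h.1, ?_⟩
  have h2 := h.2
  simp only [Real.rpow_two, ← Real.sqrt_eq_rpow] at h2
  have hF : 0 ≤ ∑' i, f i ^ 2 := tsum_nonneg fun i => sq_nonneg _
  have hG : 0 ≤ ∑' i, g i ^ 2 := tsum_nonneg fun i => sq_nonneg _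
  calc (∑' i, f i * g i) ^ 2 ≤ (√(∑' i, f i ^ 2) * √(∑' i, g i ^ 2)) ^ 2 :=
        pow_le_pow_left₀ (tsum_nonneg fun i => mul_nonneg (hf i) (hg i)) h2 2
    _ = _ := by rw [mul_pow, Real.sq_sqrt hF, Real.sq_sqrt hG]

/-- The mean square of `f` over the cube `[-π,π]^d`. -/
def meanSq (f : (Fin d → ℝ) → ℂ) : ℝ :=
  ((2 * Real.pi) ^ d)⁻¹ *
    ∫ θ in Set.Icc (fun _ : Fin d => -Real.pi) (fun _ => Real.pi), ‖f θ‖ ^ 2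

/-- Sobolev embedding into the Wiener algebra, at frequency scale `a`. -/
theorem exists_sobolev {k : ℕ} (hk : d < 2 * k) :
    ∃ C : ℝ, 0 ≤ C ∧ ∀ (f : (Fin d → ℝ) → ℂ) (a : ℝ), TorusPeriodic f →
      ContDiff ℝ (k : WithTop ℕ∞) f → 1 ≤ a → MemWiener f ∧
      wienerNorm f ^ 2 ≤ C * (a ^ d * (a ^ (2 * k))⁻¹) *
        (a ^ (2 * k) * meanSq f + ∑ i, meanSq ((dirDeriv i)^[k] f)) := by
  obtain ⟨C, hC, h⟩ := exists_tsum_inv_add_norm_pow_le hk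
  refine ⟨C * 2 ^ (2 * k), by positivity, fun f a hf hc ha => ?_⟩
  obtain ⟨hs, hsum⟩ := h a ha
  have hP0 := hasSum_sq_fourierCoeff hf hc.continuous
  have hPi : ∀ i, HasSum (fun n => ‖fourierCoeff ((dirDeriv i)^[k] f) n‖ ^ 2)
      (meanSq ((dirDeriv i)^[k] f)) := fun i => by
    obtain ⟨h1, h2, -, -⟩ := iterate_dirDeriv hf i 0 k (by simpa using hc)
    exact hasSum_sq_fourierCoeff h1 h2.continuous
  have hR := ((hP0.mul_left (a ^ (2 * k))).add
    (hasSum_sum (s := Finset.univ) fun i _ => hPi i)).mul_left (2 ^ (2 * k))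
  have hle : ∀ n, ((a + ‖n‖) ^ k * ‖fourierCoeff f n‖) ^ 2 ≤
      2 ^ (2 * k) * (a ^ (2 * k) * ‖fourierCoeff f n‖ ^ 2 +
        ∑ i, ‖fourierCoeff ((dirDeriv i)^[k] f) n‖ ^ 2) := by
    intro n
    have h1 : ∀ i, ‖fourierCoeff ((dirDeriv i)^[k] f) n‖ ^ 2 =
        ‖n i‖ ^ (2 * k) * ‖fourierCoeff f n‖ ^ 2 := by
      intro i
      obtain ⟨-, -, h3, -⟩ := iterate_dirDeriv hf i 0 k (by simpa using hc)
      rw [h3, norm_mul, mul_pow, norm_pow, norm_mul, Complex.norm_I, one_mul, ← pow_mul,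
        mul_comm k 2, Complex.norm_intCast, Int.norm_eq_abs]
    simp_rw [h1, ← Finset.sum_mul, ← add_mul]
    rw [mul_pow, ← pow_mul, mul_comm k 2, ← mul_assoc]
    refine mul_le_mul_of_nonneg_right ?_ (sq_nonneg _)
    -- a + ‖n‖ is at most twice the larger term. When that is ‖n‖, the sup norm is attained at a
    -- coordinate i, and the pure derivative in direction i controls it; there is such an i because
    -- ‖n‖ ≥ a ≥ 1 excludes d = 0.
    rcases le_total ‖n‖ a with hna | hna
    · calc (a + ‖n‖) ^ (2 * k) ≤ (2 * a) ^ (2 * k) := by gcongr; linarith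
        _ = 2 ^ (2 * k) * (a ^ (2 * k)) := mul_pow _ _ _
        _ ≤ _ := by
          gcongr
          exact le_add_of_nonneg_right (Finset.sum_nonneg fun i _ => by positivity)
    · have hn : ‖n‖ ^ (2 * k) ≤ ∑ i, ‖n i‖ ^ (2 * k) := by
        have hne : Nonempty (Fin d) := by
          by_contra hcon
          have := not_nonempty_iff.1 hcon
          have : ‖n‖ = 0 := by rw [Subsingleton.elim n 0, norm_zero]
          linarith
        obtain ⟨i, hi⟩ : ∃ i, ‖n‖ ≤ ‖n i‖ := by
          by_contra! hcon
          exact lt_irrefl _ ((pi_norm_lt_iff (by linarith)).2 hcon)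
        refine (pow_le_pow_left₀ (norm_nonneg n) hi _).trans ?_
        exact Finset.single_le_sum (f := fun i => ‖n i‖ ^ (2 * k))
          (fun i _ => by positivity) (Finset.mem_univ i)
      calc (a + ‖n‖) ^ (2 * k) ≤ (2 * ‖n‖) ^ (2 * k) := by gcongr; linarith
        _ = 2 ^ (2 * k) * (‖n‖ ^ (2 * k)) := mul_pow _ _ _
        _ ≤ _ := by
          gcongr
          exact hn.trans (le_add_of_nonneg_left (by positivity))
  have hg : Summable fun n => ((a + ‖n‖) ^ k * ‖fourierCoeff f n‖) ^ 2 :=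
    Summable.of_nonneg_of_le (fun _ => sq_nonneg _) hle hR.summable
  have hf2 : (fun n : Fin d → ℤ => ((a + ‖n‖) ^ (2 * k))⁻¹) =
      fun n => (((a + ‖n‖) ^ k)⁻¹) ^ 2 := by
    ext n; rw [inv_pow, ← pow_mul, mul_comm k 2]
  rw [hf2] at hs
  simp only [hf2] at hsum
  have hpos : ∀ n : Fin d → ℤ, 0 < (a + ‖n‖) ^ k := fun n => by positivity
  -- Cauchy–Schwarz with the weight (a + ‖n‖)^k and its inverse.
  obtain ⟨h1, h2⟩ := summable_mul_and_sq_tsum_le (fun n => (inv_pos.2 (hpos n)).le)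
    (fun n => mul_nonneg (hpos n).le (norm_nonneg _)) hs hg
  have h3 : (fun n => ((a + ‖n‖) ^ k)⁻¹ * ((a + ‖n‖) ^ k * ‖fourierCoeff f n‖)) =
      fun n => ‖fourierCoeff f n‖ := by
    ext n; rw [inv_mul_cancel_left₀ (hpos n).ne']
  rw [h3] at h1 h2
  refine ⟨⟨hf, hc.continuous, h1⟩, h2.trans ?_⟩
  have h4 : ∑' n, ((a + ‖n‖) ^ k * ‖fourierCoeff f n‖) ^ 2 ≤
      2 ^ (2 * k) * (a ^ (2 * k) * meanSq f + ∑ i, meanSq ((dirDeriv i)^[k] f)) := by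
    rw [meanSq, ← hR.tsum_eq]
    exact Summable.tsum_le_tsum hle hg hR.summable
  calc _ ≤ C * (a ^ d * (a ^ (2 * k))⁻¹) *
        (2 ^ (2 * k) * (a ^ (2 * k) * meanSq f + ∑ i, meanSq ((dirDeriv i)^[k] f))) :=
        mul_le_mul hsum h4 (tsum_nonneg fun _ => sq_nonneg _) (by positivity)
    _ = _ := by ring

theorem integral_exp_neg_sum_sq {κ : ℝ} (hκ : 0 < κ) :
    Integrable (fun ξ : Fin d → ℝ => Real.exp (-κ * ∑ i, ξ i ^ 2)) ∧
      ∫ ξ : Fin d → ℝ, Real.exp (-κ * ∑ i, ξ i ^ 2) = √(Real.pi / κ) ^ d := by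
  have h : (fun ξ : Fin d → ℝ => Real.exp (-κ * ∑ i, ξ i ^ 2)) =
      fun ξ => ∏ i, Real.exp (-κ * ξ i ^ 2) := by
    ext ξ; rw [← Real.exp_sum, Finset.mul_sum]
  rw [h]
  refine ⟨Integrable.fintype_prod fun _ => integrable_exp_neg_mul_sq hκ, ?_⟩
  rw [integral_fintype_prod_volume_eq_prod (f := fun _ x => Real.exp (-κ * x ^ 2))]
  simp only [integral_gaussian, Finset.prod_const, Finset.card_univ, Fintype.card_fin]

/-- The integral over the cube is enlarged to the full Gaussian integral. The normalisation
(2π)^{-d} absorbs its constant, since π/(2κ) ≤ (2π)²/κ. -/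
theorem meanSq_le_of_norm_le {f : (Fin d → ℝ) → ℂ} {B κ : ℝ} (hκ : 0 < κ)
    (hf : ∀ ξ, (∀ i, |ξ i| ≤ Real.pi) → ‖f ξ‖ ≤ B * Real.exp (-(κ * ∑ i, ξ i ^ 2))) :
    meanSq f ≤ B ^ 2 * √κ⁻¹ ^ d := by
  obtain ⟨hi, hval⟩ := integral_exp_neg_sum_sq (d := d) (κ := 2 * κ) (by positivity)
  have hpi := Real.pi_pos
  have h1 : ∫ θ in Set.Icc (fun _ : Fin d => -Real.pi) (fun _ => Real.pi), ‖f θ‖ ^ 2 ≤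
      ∫ θ in Set.Icc (fun _ : Fin d => -Real.pi) (fun _ => Real.pi),
        B ^ 2 * Real.exp (-(2 * κ) * ∑ i, θ i ^ 2) := by
    refine integral_mono_of_nonneg (Filter.Eventually.of_forall fun _ => sq_nonneg _)
      (hi.const_mul _).integrableOn ?_
    rw [Filter.EventuallyLE, ae_restrict_iff' measurableSet_Icc]
    refine Filter.Eventually.of_forall fun θ hθ => ?_
    have h2 := hf θ fun i => abs_le.2 ⟨hθ.1 i, hθ.2 i⟩
    calc ‖f θ‖ ^ 2 ≤ (B * Real.exp (-(κ * ∑ i, θ i ^ 2))) ^ 2 := by gcongr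
      _ = _ := by rw [mul_pow, ← Real.exp_nat_mul]; push_cast; ring_nf
  have h3 : ∫ θ in Set.Icc (fun _ : Fin d => -Real.pi) (fun _ => Real.pi),
        B ^ 2 * Real.exp (-(2 * κ) * ∑ i, θ i ^ 2) ≤ B ^ 2 * √(Real.pi / (2 * κ)) ^ d := by
    rw [← hval, integral_const_mul]
    refine mul_le_mul_of_nonneg_left ?_ (sq_nonneg B)
    exact setIntegral_le_integral hi (Filter.Eventually.of_forall fun _ => (Real.exp_pos _).le)
  rw [meanSq]
  calc _ ≤ ((2 * Real.pi) ^ d)⁻¹ * (B ^ 2 * √(Real.pi / (2 * κ)) ^ d) := by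
        gcongr; exact h1.trans h3
    _ = B ^ 2 * (√(Real.pi / (2 * κ)) / (2 * Real.pi)) ^ d := by rw [div_pow]; ring
    _ ≤ _ := by
        gcongr
        rw [div_le_iff₀ (by positivity), Real.sqrt_le_iff]
        refine ⟨by positivity, ?_⟩
        rw [mul_pow, Real.sq_sqrt (by positivity)]
        have : Real.pi / (2 * κ) = κ⁻¹ * (Real.pi / 2) := by field_simp
        rw [this]
        gcongr
        nlinarith [Real.pi_gt_three]

/-- A periodic function with Gaussian bounds on itself and on its derivatives of order `k` has
Wiener norm controlled by the ratio of its frequency scale `a` to the width of the Gaussian. -/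
theorem exists_wienerNorm_le_of_gaussian {k : ℕ} (hk : d < 2 * k) :
    ∃ C : ℝ, 0 < C ∧ ∀ (f : (Fin d → ℝ) → ℂ) (a B κ : ℝ), TorusPeriodic f →
      ContDiff ℝ (k : WithTop ℕ∞) f → 1 ≤ a → 0 ≤ B → 0 < κ →
      (∀ ξ, (∀ i, |ξ i| ≤ Real.pi) → ‖f ξ‖ ≤ B * Real.exp (-(κ * ∑ i, ξ i ^ 2))) →
      (∀ ξ, (∀ i, |ξ i| ≤ Real.pi) →
        ‖iteratedFDeriv ℝ k f ξ‖ ≤ B * a ^ k * Real.exp (-(κ * ∑ i, ξ i ^ 2))) →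
      MemWiener f ∧ wienerNorm f ≤ C * B * √((a / √κ) ^ d) := by
  obtain ⟨C, hC, h⟩ := exists_sobolev hk
  -- 1 + d counts the mean squares of f and of its d pure derivatives; the last 1 only makes the
  -- constant positive.
  refine ⟨√(C * (1 + d)) + 1, by positivity, fun f a B κ hf hc ha hB hκ h0 h1 => ?_⟩
  obtain ⟨hW, hn⟩ := h f a hf hc ha
  refine ⟨hW, ?_⟩
  have hm0 := meanSq_le_of_norm_le hκ h0
  have hm1 : ∀ i, meanSq ((dirDeriv i)^[k] f) ≤ (B * a ^ k) ^ 2 * √κ⁻¹ ^ d := by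
    intro i
    refine meanSq_le_of_norm_le hκ fun ξ hξ => ?_
    obtain ⟨-, -, -, h4⟩ := iterate_dirDeriv hf i 0 k (by simpa using hc)
    rw [h4]
    refine (ContinuousMultilinearMap.le_opNorm _ _).trans ?_
    have hs : ‖(Pi.single i 1 : Fin d → ℝ)‖ = 1 := by simp [Pi.norm_single]
    simpa [hs] using h1 ξ hξ
  have hsq : wienerNorm f ^ 2 ≤ (C * (1 + d)) * B ^ 2 * (a / √κ) ^ d := by
    calc wienerNorm f ^ 2 ≤ C * (a ^ d * (a ^ (2 * k))⁻¹) *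
          (a ^ (2 * k) * (B ^ 2 * √κ⁻¹ ^ d) + ∑ _i : Fin d, (B * a ^ k) ^ 2 * √κ⁻¹ ^ d) := by
          refine hn.trans (mul_le_mul_of_nonneg_left ?_ (by positivity))
          exact add_le_add (by gcongr) (Finset.sum_le_sum fun i _ => hm1 i)
      _ = (C * (1 + d)) * B ^ 2 * (a / √κ) ^ d := by
          rw [Finset.sum_const, Finset.card_univ, Fintype.card_fin, nsmul_eq_mul, Real.sqrt_inv,
            mul_pow, ← pow_mul, mul_comm k 2, div_pow, inv_pow]
          field_simp
  calc wienerNorm f = √(wienerNorm f ^ 2) :=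
        (Real.sqrt_sq (tsum_nonneg fun _ => norm_nonneg _)).symm
    _ ≤ √((C * (1 + d)) * B ^ 2 * (a / √κ) ^ d) := Real.sqrt_le_sqrt hsq
    _ = √(C * (1 + d)) * B * √((a / √κ) ^ d) := by
        rw [Real.sqrt_mul (by positivity), Real.sqrt_mul (by positivity), Real.sqrt_sq hB]
    _ ≤ _ := by gcongr; linarith

end SobolevEmbedding

/-! ### Smoothness and quadratic decay of the exponents -/

section LevyExponent

theorem norm_exp_I_mul_mul (k : ℤ) (θ : ℝ) : ‖Complex.exp (Complex.I * k * θ)‖ = 1 := by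
  rw [show Complex.I * k * θ = ((k * θ : ℝ) : ℂ) * Complex.I by push_cast; ring,
    Complex.norm_exp_ofReal_mul_I]

theorem integrable_exp_I_mul_mul (ρ : Measure ℤ) [IsFiniteMeasure ρ] (θ : ℝ) :
    Integrable (fun k : ℤ => Complex.exp (Complex.I * k * θ)) ρ :=
  Integrable.of_bound (C := 1) (measurable_of_countable _).aestronglyMeasurable
    (Filter.Eventually.of_forall fun k => (norm_exp_I_mul_mul k θ).le)

/-- The transform is the characteristic function of the image of `ρ` in ℝ, whose smoothness follows
from the moment. Order 0 is treated apart, where membership in L⁰ is mere measurability. -/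
theorem contDiff_fourierInt {ρ : Measure ℤ} [IsProbabilityMeasure ρ] {N : ℕ}
    (h : HasMoment N ρ) : ContDiff ℝ (N : WithTop ℕ∞) (fourierInt ρ) := by
  have hm : Measurable (fun k : ℤ => (k : ℝ)) := measurable_of_countable _
  have h1 : fourierInt ρ = charFun (ρ.map fun k : ℤ => (k : ℝ)) := by
    ext θ
    rw [charFun_apply_real, integral_map hm.aemeasurable (by fun_prop), fourierInt]
    congr 1
    ext k
    congr 1
    push_cast; ring
  have : IsProbabilityMeasure (ρ.map fun k : ℤ => (k : ℝ)) :=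
    Measure.isProbabilityMeasure_map hm.aemeasurable
  rw [h1]
  refine contDiff_charFun ?_
  rw [memLp_map_measure_iff (by fun_prop) hm.aemeasurable]
  change MemLp (fun k : ℤ => (k : ℝ)) N ρ
  rcases Nat.eq_zero_or_pos N with rfl | hN
  · rw [Nat.cast_zero]
    exact memLp_zero_iff_aestronglyMeasurable.2 hm.aestronglyMeasurable
  · rw [← integrable_norm_rpow_iff hm.aestronglyMeasurable (p := (N : ENNReal))
      (by simpa using hN.ne') (by simp)]
    refine h.congr (Filter.Eventually.of_forall fun k => ?_)
    simp

/-- By continuity φ stays within distance 1 < π of φ(θ₀) near θ₀, so there φ − φ(θ₀) is the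
principal logarithm of e^{φ − φ(θ₀)}. -/
theorem contDiff_of_exp_comp {φ : ℝ → ℂ} {N : WithTop ℕ∞} (hφ : Continuous φ)
    (h : ContDiff ℝ N fun θ => Complex.exp (φ θ)) : ContDiff ℝ N φ := by
  rw [contDiff_iff_contDiffAt]
  intro θ₀
  have h1 : ContDiffAt ℝ N
      (fun θ => φ θ₀ + Complex.log (Complex.exp (φ θ) * Complex.exp (-φ θ₀))) θ₀ := by
    refine contDiffAt_const.add (ContDiffAt.comp θ₀ (g := Complex.log)
      ((Complex.contDiffAt_log ?_).restrict_scalars ℝ) (h.contDiffAt.mul contDiffAt_const))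
    rw [← Complex.exp_add, add_neg_cancel, Complex.exp_zero]
    exact Complex.one_mem_slitPlane
  refine h1.congr_of_eventuallyEq ?_
  have h2 : ∀ᶠ θ in nhds θ₀, ‖φ θ - φ θ₀‖ < 1 := by
    have := (Metric.continuous_iff'.1 hφ) θ₀ 1 one_pos
    simpa [dist_eq_norm] using this
  filter_upwards [h2] with θ hθ
  have h3 := (Complex.abs_im_le_norm (φ θ - φ θ₀)).trans_lt hθ
  have h4 := abs_lt.1 h3
  rw [← Complex.exp_add, ← sub_eq_add_neg, Complex.log_exp]
  · ring
  · linarith [Real.pi_gt_three]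
  · linarith [Real.pi_gt_three]

theorem IsLevyExponent.contDiff {ρ : Measure ℤ} [IsProbabilityMeasure ρ] {φ : ℝ → ℂ}
    (h : IsLevyExponent ρ φ) {N : ℕ} (hN : HasMoment N ρ) : ContDiff ℝ (N : WithTop ℕ∞) φ := by
  refine contDiff_of_exp_comp h.continuous ?_
  have : (fun θ => Complex.exp (φ θ)) = fourierInt ρ := funext fun θ => (h.fourier_eq θ).symm
  rw [this]
  exact contDiff_fourierInt hN

theorem norm_fourierInt_le (ρ : Measure ℤ) [IsProbabilityMeasure ρ] (θ : ℝ) :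
    ‖fourierInt ρ θ‖ ≤ 1 := by
  have h := norm_integral_le_of_norm_le_const (μ := ρ) (C := 1)
    (f := fun k : ℤ => Complex.exp (Complex.I * k * θ))
    (Filter.Eventually.of_forall fun k => (norm_exp_I_mul_mul k θ).le)
  simpa [fourierInt] using h

theorem IsLevyExponent.norm_fourierInt {ρ : Measure ℤ} {φ : ℝ → ℂ}
    (h : IsLevyExponent ρ φ) (θ : ℝ) : ‖fourierInt ρ θ‖ = Real.exp (φ θ).re := by
  rw [h.fourier_eq, Complex.norm_exp]

theorem IsLevyExponent.re_nonpos {ρ : Measure ℤ} [IsProbabilityMeasure ρ] {φ : ℝ → ℂ}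
    (h : IsLevyExponent ρ φ) (θ : ℝ) : (φ θ).re ≤ 0 := by
  have := norm_fourierInt_le ρ θ
  rwa [h.norm_fourierInt, Real.exp_le_one_iff] at this

/-- The defect `1 - |ρ̂(θ)|` as a mean square deviation. -/
theorem exists_integral_norm_sub_one_sq (ρ : Measure ℤ) [IsProbabilityMeasure ρ] (θ : ℝ) :
    ∃ ζ : ℂ, ‖ζ‖ = 1 ∧ ζ * fourierInt ρ θ = ‖fourierInt ρ θ‖ ∧
      Integrable (fun k : ℤ => ‖ζ * Complex.exp (Complex.I * k * θ) - 1‖ ^ 2 / 2) ρ ∧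
      ∫ k : ℤ, ‖ζ * Complex.exp (Complex.I * k * θ) - 1‖ ^ 2 / 2 ∂ρ = 1 - ‖fourierInt ρ θ‖ := by
  -- ζ rotates the transform onto the nonnegative reals. For a unit number z one then has |z − 1|²/2
  -- = 1 − Re z.
  obtain ⟨ζ, hζ, hζ2⟩ : ∃ ζ : ℂ, ‖ζ‖ = 1 ∧ ζ * fourierInt ρ θ = ‖fourierInt ρ θ‖ := by
    by_cases h0 : fourierInt ρ θ = 0
    · exact ⟨1, by simp, by simp [h0]⟩
    · have hn : (‖fourierInt ρ θ‖ : ℂ) ≠ 0 := by simpa using h0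
      refine ⟨(‖fourierInt ρ θ‖ : ℂ) / fourierInt ρ θ, ?_, ?_⟩
      · rw [norm_div, Complex.norm_real, norm_norm, div_self]
        simpa using h0
      · field_simp
  have hi : Integrable (fun k : ℤ => ζ * Complex.exp (Complex.I * k * θ)) ρ :=
    (integrable_exp_I_mul_mul ρ θ).const_mul ζ
  have heq : (fun k : ℤ => ‖ζ * Complex.exp (Complex.I * k * θ) - 1‖ ^ 2 / 2) =
      fun k : ℤ => 1 - (ζ * Complex.exp (Complex.I * k * θ)).re := by
    ext k
    have h1 : ‖ζ * Complex.exp (Complex.I * k * θ)‖ = 1 := by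
      rw [norm_mul, hζ, norm_exp_I_mul_mul, one_mul]
    have h2 := Complex.sq_norm (ζ * Complex.exp (Complex.I * k * θ))
    rw [h1, Complex.normSq_apply] at h2
    rw [Complex.sq_norm, Complex.normSq_apply]
    simp only [Complex.sub_re, Complex.sub_im, Complex.one_re, Complex.one_im]
    linarith
  have hre : Integrable (fun k : ℤ => (ζ * Complex.exp (Complex.I * k * θ)).re) ρ := hi.re
  refine ⟨ζ, hζ, hζ2, ?_, ?_⟩
  · rw [heq]; exact (integrable_const _).sub hre
  · rw [heq, integral_sub (integrable_const _) hre]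
    have h3 : ∫ k : ℤ, (ζ * Complex.exp (Complex.I * k * θ)).re ∂ρ =
        (∫ k : ℤ, ζ * Complex.exp (Complex.I * k * θ) ∂ρ).re := integral_re hi
    rw [h3, integral_const_mul]
    change _ - (ζ * fourierInt ρ θ).re = _
    rw [hζ2]
    simp

/-- The mean square deviation of the rotated character from 1 vanishes, so the character is almost
surely constant, equal to its mean. -/
theorem ae_exp_eq_of_norm_fourierInt_eq_one {ρ : Measure ℤ} [IsProbabilityMeasure ρ] {θ : ℝ}
    (h : ‖fourierInt ρ θ‖ = 1) :
    ∀ᵐ k : ℤ ∂ρ, Complex.exp (Complex.I * (k : ℂ) * θ) = fourierInt ρ θ := by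
  obtain ⟨ζ, hζ, hζ2, hi, hval⟩ := exists_integral_norm_sub_one_sq ρ θ
  rw [h, sub_self, integral_eq_zero_iff_of_nonneg (fun k => by positivity) hi] at hval
  have hζ0 : ζ ≠ 0 := by rintro rfl; simp at hζ
  filter_upwards [hval] with k hk
  have h1 : ζ * Complex.exp (Complex.I * k * θ) = 1 := by
    simpa [sub_eq_zero] using hk
  rw [h] at hζ2
  exact mul_left_cancel₀ hζ0 (h1.trans (by simpa using hζ2.symm))

theorem IsLevyExponent.bounded {ρ : Measure ℤ} {φ : ℝ → ℂ} (h : IsLevyExponent ρ φ) :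
    ∃ B, ∀ θ, ‖φ θ‖ ≤ B := by
  obtain ⟨B, hB⟩ := isBounded_iff_forall_norm_le.1
    (h.periodic.isBounded_of_continuous (by positivity) h.continuous)
  exact ⟨B, fun θ => hB _ ⟨θ, rfl⟩⟩

/-- If the real part of the exponent vanishes at `θ`, then infinite divisibility makes the
exponent linear along the multiples of `θ`, hence zero by periodicity. -/
theorem IsLevyExponent.eq_zero_of_re_eq_zero {ρ : Measure ℤ} {φ : ℝ → ℂ}
    (h : IsLevyExponent ρ φ) {θ : ℝ} (hθ : (φ θ).re = 0) : φ θ = 0 := by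
  have key : ∀ j : ℕ, φ (j * θ) = j * φ θ := by
    intro j
    -- For the n-th root of ρ the character at θ is almost surely constant, so φ(jθ) − jφ(θ) is an
    -- integer multiple of 2πin. A nonzero multiple would have norm at least 6n, hence n is chosen
    -- above the norm of the difference.
    obtain ⟨n, hn⟩ := exists_nat_gt ‖φ (j * θ) - j * φ θ‖
    have hn0 : 0 < (n : ℝ) := (norm_nonneg _).trans_lt hn
    have hn1 : 1 ≤ n := by exact_mod_cast hn0
    obtain ⟨ρn, hp, hρ⟩ := h.divisible n hn1
    have hnorm : ‖fourierInt ρn θ‖ = 1 := by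
      rw [hρ, Complex.norm_exp]
      simp [hθ]
    have hae := ae_exp_eq_of_norm_fourierInt_eq_one hnorm
    have h1 : fourierInt ρn (j * θ) = fourierInt ρn θ ^ j := by
      have h2 : fourierInt ρn (j * θ) = ∫ _k : ℤ, fourierInt ρn θ ^ j ∂ρn := by
        rw [fourierInt]
        refine integral_congr_ae ?_
        filter_upwards [hae] with k hk
        rw [← hk, ← Complex.exp_nat_mul]
        congr 1
        push_cast; ring
      rw [h2]; simp
    rw [hρ, hρ, ← Complex.exp_nat_mul, Complex.exp_eq_exp_iff_exists_int] at h1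
    obtain ⟨m, hm⟩ := h1
    have hn' : (n : ℂ) ≠ 0 := by exact_mod_cast hn0.ne'
    have h3 : φ (j * θ) - j * φ θ = n * m * (2 * Real.pi * Complex.I) := by
      field_simp at hm
      linear_combination hm
    have hm0 : m = 0 := by
      by_contra hm0
      have h4 : (1 : ℝ) ≤ |(m : ℝ)| := by exact_mod_cast Int.one_le_abs hm0
      rw [h3] at hn
      simp only [norm_mul, Complex.norm_natCast, Complex.norm_intCast, Complex.norm_I,
        Complex.norm_ofNat, Complex.norm_real, Real.norm_eq_abs, mul_one,
        abs_of_pos Real.pi_pos] at hn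
      have h5 : (n : ℝ) * 1 * (2 * 3) ≤ n * |(m : ℝ)| * (2 * Real.pi) := by
        gcongr; exact Real.pi_gt_three.le
      linarith
    rw [hm0] at h3
    simpa [sub_eq_zero] using h3
  obtain ⟨B, hB⟩ := h.bounded
  by_contra hne
  have hpos : 0 < ‖φ θ‖ := norm_pos_iff.2 hne
  obtain ⟨j, hj⟩ := exists_nat_gt (B / ‖φ θ‖)
  rw [div_lt_iff₀ hpos] at hj
  have := hB (j * θ)
  rw [key j, norm_mul, Complex.norm_natCast] at this
  linarith

/-- The subgroup of the integers `k` with `exp(i k θ) = 1`. -/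
def stabilizer (θ : ℝ) : AddSubgroup ℤ where
  carrier := {k | Complex.exp (Complex.I * (k : ℂ) * θ) = 1}
  zero_mem' := by simp
  add_mem' {a b} ha hb := by
    simp only [Set.mem_ofPred_eq] at ha hb ⊢
    rw [show Complex.I * ((a + b : ℤ) : ℂ) * θ = Complex.I * a * θ + Complex.I * b * θ by
      push_cast; ring, Complex.exp_add, ha, hb, one_mul]
  neg_mem' {a} ha := by
    simp only [Set.mem_ofPred_eq] at ha ⊢
    rw [show Complex.I * ((-a : ℤ) : ℂ) * θ = -(Complex.I * a * θ) by
      push_cast; ring, Complex.exp_neg, ha, inv_one]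

/-- If the real part vanished, infinite divisibility would upgrade |ρ̂(θ)| = 1 to ρ̂(θ) = 1; this
excludes concentration on a proper coset, which minimality of the lattice alone permits. Then `ρ` is
carried by the stabilizer of θ, which must be all of ℤ, so θ lies in 2πℤ. -/
theorem IsLevyExponent.re_neg {ρ : Measure ℤ} [IsProbabilityMeasure ρ] {φ : ℝ → ℂ}
    (h : IsLevyExponent ρ φ) (hl : HasMinimalLattice ρ) {θ : ℝ} (hθ : |θ| ≤ Real.pi)
    (hθ0 : θ ≠ 0) : (φ θ).re < 0 := by
  refine lt_of_le_of_ne (h.re_nonpos θ) fun h0 => ?_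
  have h1 : fourierInt ρ θ = 1 := by
    rw [h.fourier_eq, h.eq_zero_of_re_eq_zero h0, Complex.exp_zero]
  have hae := ae_exp_eq_of_norm_fourierInt_eq_one (ρ := ρ) (θ := θ) (by simp [h1])
  rw [h1] at hae
  have htop : stabilizer θ = ⊤ := hl _ (by rw [ae_iff] at hae; exact hae)
  have hmem : (1 : ℤ) ∈ stabilizer θ := by rw [htop]; trivial
  have h2 : Complex.exp (Complex.I * ((1 : ℤ) : ℂ) * θ) = 1 := hmem
  rw [Complex.exp_eq_one_iff] at h2
  obtain ⟨m, hm⟩ := h2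
  have h3 : θ = m * (2 * Real.pi) := by
    have h4 : (θ : ℂ) = m * (2 * Real.pi) := by
      have h5 : Complex.I * (θ : ℂ) = Complex.I * (m * (2 * Real.pi)) := by
        push_cast at hm; linear_combination hm
      exact mul_left_cancel₀ Complex.I_ne_zero h5
    exact_mod_cast h4
  have hm0 : m ≠ 0 := by rintro rfl; simp at h3; exact hθ0 h3
  have h4 : (1 : ℝ) ≤ |(m : ℝ)| := by exact_mod_cast Int.one_le_abs hm0
  have hpi := Real.pi_pos
  rw [h3, abs_mul, abs_of_pos (by positivity : 0 < 2 * Real.pi)] at hθ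
  nlinarith

/-- A single atom would give a transform of modulus 1 everywhere, against strict negativity at θ =
1. -/
theorem IsLevyExponent.exists_two_atoms {ρ : Measure ℤ} [IsProbabilityMeasure ρ] {φ : ℝ → ℂ}
    (h : IsLevyExponent ρ φ) (hl : HasMinimalLattice ρ) :
    ∃ k l : ℤ, k ≠ l ∧ 0 < ρ.real {k} ∧ 0 < ρ.real {l} := by
  obtain ⟨k, hk⟩ : ∃ k : ℤ, ρ {k} ≠ 0 := by
    by_contra! hcon
    have := (measure_iUnion_null_iff (μ := ρ) (s := fun k : ℤ => {k})).2 hcon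
    rw [Set.iUnion_of_singleton] at this
    simp at this
  have hpos : ∀ k : ℤ, ρ {k} ≠ 0 → 0 < ρ.real {k} := fun k hk =>
    ENNReal.toReal_pos hk (measure_ne_top _ _)
  by_contra! hcon
  have hae : ∀ᵐ l ∂ρ, l = k := by
    rw [ae_iff]
    have h1 : {l : ℤ | ¬l = k} = ⋃ l : {l : ℤ // l ≠ k}, {(l : ℤ)} := by ext; simp
    rw [h1, measure_iUnion_null_iff]
    rintro ⟨l, hlk⟩
    by_contra hne
    exact absurd (hpos l hne) (not_lt.2 (hcon k l hlk.symm (hpos k hk)))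
  have h2 : fourierInt ρ 1 = Complex.exp (Complex.I * k * (1 : ℝ)) := by
    have : fourierInt ρ 1 = ∫ _l : ℤ, Complex.exp (Complex.I * k * (1 : ℝ)) ∂ρ := by
      refine integral_congr_ae ?_
      filter_upwards [hae] with l hl
      rw [hl]
    rw [this]; simp
  have h3 := h.norm_fourierInt 1
  rw [h2, norm_exp_I_mul_mul] at h3
  have h4 := h.re_neg hl (θ := 1) (by rw [abs_one]; linarith [Real.pi_gt_three]) one_ne_zero
  have := Real.exp_lt_one_iff.2 h4
  linarith

/-- Near 0, the characters at two atoms k ≠ l differ by at least (2/π)|θ| by Jordan's inequality,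
valid for |θ| ≤ π/|k − l|. This bounds 1 − |ρ̂(θ)| below by a multiple of θ², and 1 + x ≤ e^x passes
to the exponent. On the remaining compact set the real part has a negative maximum. -/
theorem IsLevyExponent.exists_re_le {ρ : Measure ℤ} [IsProbabilityMeasure ρ] {φ : ℝ → ℂ}
    (h : IsLevyExponent ρ φ) (hl : HasMinimalLattice ρ) :
    ∃ c : ℝ, 0 < c ∧ ∀ θ : ℝ, |θ| ≤ Real.pi → (φ θ).re ≤ -(c * θ ^ 2) := by
  have hpi := Real.pi_pos
  obtain ⟨k, l, hkl, hk, hl'⟩ := h.exists_two_atoms hl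
  set p := min (ρ.real {k}) (ρ.real {l}) with hp
  have hp0 : 0 < p := lt_min hk hl'
  have hm : (1 : ℝ) ≤ |((k - l : ℤ) : ℝ)| := by
    exact_mod_cast Int.one_le_abs (sub_ne_zero.2 hkl)
  set δ := Real.pi / |((k - l : ℤ) : ℝ)| with hδ
  have hδ0 : 0 < δ := by positivity
  have hnear : ∀ θ : ℝ, |θ| ≤ δ → (φ θ).re ≤ -(p / Real.pi ^ 2 * θ ^ 2) := by
    intro θ hθ
    obtain ⟨ζ, hζ, -, hi, hval⟩ := exists_integral_norm_sub_one_sq ρ θ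
    set z1 := ζ * Complex.exp (Complex.I * k * θ) with hz1
    set z2 := ζ * Complex.exp (Complex.I * l * θ) with hz2
    have h1 : p / 2 * (‖z1 - 1‖ ^ 2 + ‖z2 - 1‖ ^ 2) ≤ 1 - ‖fourierInt ρ θ‖ := by
      rw [← hval]
      have h2 := setIntegral_le_integral (s := (({k, l} : Finset ℤ) : Set ℤ)) hi
        (Filter.Eventually.of_forall fun k => by positivity)
      refine le_trans ?_ h2
      rw [setIntegral_finset _ hi.integrableOn, Finset.sum_pair hkl, smul_eq_mul, smul_eq_mul]
      have h3 : p ≤ ρ.real {k} := min_le_left _ _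
      have h4 : p ≤ ρ.real {l} := min_le_right _ _
      have h5 : 0 ≤ ‖z1 - 1‖ ^ 2 := by positivity
      have h6 : 0 ≤ ‖z2 - 1‖ ^ 2 := by positivity
      nlinarith
    have h7 : ‖z1 - z2‖ ^ 2 ≤ 2 * (‖z1 - 1‖ ^ 2 + ‖z2 - 1‖ ^ 2) := by
      have : ‖z1 - z2‖ ≤ ‖z1 - 1‖ + ‖z2 - 1‖ := by
        rw [show z1 - z2 = (z1 - 1) - (z2 - 1) by ring]; exact norm_sub_le _ _
      nlinarith [sq_nonneg (‖z1 - 1‖ - ‖z2 - 1‖), norm_nonneg (z1 - z2)]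
    have h8 : 2 / Real.pi * |θ| ≤ ‖z1 - z2‖ := by
      have h9 : z1 - z2 = ζ * Complex.exp (Complex.I * l * θ) *
          (Complex.exp (Complex.I * (((k - l : ℤ) * θ : ℝ) : ℂ)) - 1) := by
        rw [mul_sub, mul_assoc, ← Complex.exp_add, mul_one, hz1, hz2]
        congr 3
        push_cast; ring
      rw [h9, norm_mul, norm_mul, hζ, norm_exp_I_mul_mul, one_mul, one_mul,
        Complex.norm_exp_I_mul_ofReal_sub_one, norm_mul, Real.norm_eq_abs, Real.norm_eq_abs]
      have h10 : |((k - l : ℤ) : ℝ) * θ / 2| ≤ Real.pi / 2 := by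
        rw [abs_div, abs_mul, abs_two]
        rw [hδ, le_div_iff₀ (by positivity)] at hθ
        gcongr; linarith
      have h11 := Real.mul_abs_le_abs_sin h10
      rw [abs_two]
      have h12 : |θ| ≤ |((k - l : ℤ) : ℝ) * θ| := by
        rw [abs_mul]; nlinarith [abs_nonneg θ]
      rw [abs_div, abs_two] at h11
      calc 2 / Real.pi * |θ| ≤ 2 / Real.pi * |((k - l : ℤ) : ℝ) * θ| := by gcongr
        _ = 2 * (2 / Real.pi * (|((k - l : ℤ) : ℝ) * θ| / 2)) := by ring
        _ ≤ _ := by gcongr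
    have h13 : (2 / Real.pi * |θ|) ^ 2 ≤ ‖z1 - z2‖ ^ 2 := by gcongr
    rw [mul_pow, sq_abs] at h13
    have h14 : p / Real.pi ^ 2 * θ ^ 2 ≤ 1 - ‖fourierInt ρ θ‖ := by
      refine le_trans ?_ h1
      have : p / Real.pi ^ 2 * θ ^ 2 = p / 4 * ((2 / Real.pi) ^ 2 * θ ^ 2) := by
        field_simp; ring
      rw [this]
      nlinarith
    rw [h.norm_fourierInt] at h14
    have := Real.add_one_le_exp (φ θ).re
    linarith
  have hcomp : IsCompact (Metric.closedBall (0 : ℝ) Real.pi \ Metric.ball 0 δ) :=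
    (isCompact_closedBall _ _).diff Metric.isOpen_ball
  have hne : (Metric.closedBall (0 : ℝ) Real.pi \ Metric.ball 0 δ).Nonempty := by
    refine ⟨Real.pi, by simp [abs_of_pos hpi], ?_⟩
    simp only [Metric.mem_ball, dist_zero_right, Real.norm_eq_abs, abs_of_pos hpi, not_lt, hδ]
    exact div_le_self hpi.le hm
  obtain ⟨θ₁, hθ₁, hmax⟩ := hcomp.exists_isMaxOn hne
    (Complex.continuous_re.comp h.continuous).continuousOn
  have hθ₁a : |θ₁| ≤ Real.pi := by simpa using hθ₁.1
  have hθ₁b : δ ≤ |θ₁| := by simpa using hθ₁.2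
  have hneg := h.re_neg hl hθ₁a (by rintro rfl; simp at hθ₁b; linarith)
  refine ⟨min (p / Real.pi ^ 2) (-(φ θ₁).re / Real.pi ^ 2),
    lt_min (by positivity) (div_pos (by linarith) (by positivity)), fun θ hθ => ?_⟩
  rcases le_or_gt |θ| δ with h1 | h1
  · refine (hnear θ h1).trans (neg_le_neg ?_)
    gcongr
    exact min_le_left _ _
  · have h2 : (φ θ).re ≤ (φ θ₁).re := hmax ⟨by simpa using hθ, by simpa using h1.le⟩
    refine h2.trans ?_
    have h3 : min (p / Real.pi ^ 2) (-(φ θ₁).re / Real.pi ^ 2) * θ ^ 2 ≤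
        -(φ θ₁).re / Real.pi ^ 2 * Real.pi ^ 2 := by
      refine mul_le_mul (min_le_right _ _) (sq_le_sq' (by linarith [(abs_le.1 hθ).1])
        (abs_le.1 hθ).2) (sq_nonneg _) (div_nonneg (by linarith) (by positivity))
    rw [div_mul_cancel₀ _ (by positivity)] at h3
    linarith

variable {d : ℕ} {ρ : Fin d → Measure ℤ} {φ : Fin d → ℝ → ℂ}

theorem bddAbove_decay (hprob : ∀ i, IsProbabilityMeasure (ρ i))
    (hφ : ∀ i, IsLevyExponent (ρ i) (φ i)) : BddAbove {x : ℝ | ∃ (i : Fin d) (θ : ℝ),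
      |θ| ≤ Real.pi ∧ θ ≠ 0 ∧ x = (φ i θ).re / θ ^ 2} := by
  refine ⟨0, ?_⟩
  rintro x ⟨i, θ, -, -, rfl⟩
  have := hprob i
  exact div_nonpos_of_nonpos_of_nonneg ((hφ i).re_nonpos θ) (sq_nonneg θ)

theorem re_le_decayM (hprob : ∀ i, IsProbabilityMeasure (ρ i))
    (hφ : ∀ i, IsLevyExponent (ρ i) (φ i)) (i : Fin d) {θ : ℝ} (hθ : |θ| ≤ Real.pi) :
    (φ i θ).re ≤ -(decayM φ * θ ^ 2) := by
  by_cases h0 : θ = 0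
  · simp [h0, (hφ i).zero]
  · have h1 := le_csSup (bddAbove_decay hprob hφ) ⟨i, θ, hθ, h0, rfl⟩
    have hpos : 0 < θ ^ 2 := by positivity
    rw [div_le_iff₀ hpos] at h1
    rw [decayM]
    linarith

theorem decayM_pos (hd : 1 ≤ d) (hprob : ∀ i, IsProbabilityMeasure (ρ i))
    (hφ : ∀ i, IsLevyExponent (ρ i) (φ i)) (hl : ∀ i, HasMinimalLattice (ρ i)) :
    0 < decayM φ := by
  have h1 : ∀ i, ∃ c : ℝ, 0 < c ∧ ∀ θ : ℝ, |θ| ≤ Real.pi → (φ i θ).re ≤ -(c * θ ^ 2) :=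
    fun i => by
      have := hprob i
      exact (hφ i).exists_re_le (hl i)
  choose c hc hc2 using h1
  have hne : (Finset.univ : Finset (Fin d)).Nonempty := ⟨⟨0, by omega⟩, Finset.mem_univ _⟩
  have hpos : 0 < Finset.univ.inf' hne c := (Finset.lt_inf'_iff _).2 fun i _ => hc i
  rw [decayM, neg_pos]
  refine lt_of_le_of_lt (csSup_le ⟨_, ⟨0, by omega⟩, Real.pi, by rw [abs_of_pos Real.pi_pos],
    Real.pi_ne_zero, rfl⟩ ?_) (neg_lt_zero.2 hpos)
  rintro x ⟨i, θ, hθ, h0, rfl⟩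
  have h2 : 0 < θ ^ 2 := by positivity
  rw [div_le_iff₀ h2]
  refine (hc2 i θ hθ).trans ?_
  have h3 : Finset.univ.inf' hne c ≤ c i := Finset.inf'_le _ (Finset.mem_univ i)
  nlinarith

end LevyExponent

/-! ### Calculus of pointwise derivative bounds -/

section DerivativeBounds

variable {d : ℕ}

/-- At the point `ξ`, the derivatives of `f` up to order `N` grow at most like those of a function
of size `B` oscillating at frequency `a`. -/
def DerivBound (N : ℕ) (a B : ℝ) (f : (Fin d → ℝ) → ℂ) (ξ : Fin d → ℝ) : Prop :=
  ∀ j ≤ N, ‖iteratedFDeriv ℝ j f ξ‖ ≤ B * a ^ j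

theorem DerivBound.mono {N : ℕ} {a b A B : ℝ} {f : (Fin d → ℝ) → ℂ} {ξ : Fin d → ℝ}
    (h : DerivBound N a A f ξ) (ha : 0 ≤ a) (hab : a ≤ b) (hA : 0 ≤ A) (hAB : A ≤ B) :
    DerivBound N b B f ξ := fun j hj => (h j hj).trans (by have := hA.trans hAB; gcongr)

theorem DerivBound.norm_le {N : ℕ} {a B : ℝ} {f : (Fin d → ℝ) → ℂ} {ξ : Fin d → ℝ}
    (h : DerivBound N a B f ξ) : ‖f ξ‖ ≤ B := by
  simpa using h 0 (Nat.zero_le _)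

/-- Leibniz's rule: the powers of `a` multiply to `a ^ j`, and the binomial coefficients sum to 2^j
≤ 2^N. -/
theorem DerivBound.mul {N : ℕ} {a A B : ℝ} {f g : (Fin d → ℝ) → ℂ} {ξ : Fin d → ℝ}
    (hf : DerivBound N a A f ξ) (hg : DerivBound N a B g ξ)
    (hfc : ContDiff ℝ (N : WithTop ℕ∞) f) (hgc : ContDiff ℝ (N : WithTop ℕ∞) g) (ha : 0 ≤ a)
    (hA : 0 ≤ A) (hB : 0 ≤ B) : DerivBound N a (2 ^ N * (A * B)) (f * g) ξ := by
  intro j hj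
  have h := norm_iteratedFDeriv_mul_le hfc hgc ξ (n := j) (by exact_mod_cast hj)
  refine h.trans ?_
  calc _ ≤ ∑ i ∈ Finset.range (j + 1), (j.choose i : ℝ) * (A * B * a ^ j) := by
        refine Finset.sum_le_sum fun i hi => ?_
        have hij : i ≤ j := Nat.lt_succ_iff.1 (Finset.mem_range.1 hi)
        rw [mul_assoc]
        refine mul_le_mul_of_nonneg_left ?_ (Nat.cast_nonneg _)
        calc _ ≤ (A * a ^ i) * (B * a ^ (j - i)) :=
              mul_le_mul (hf i (hij.trans hj)) (hg (j - i) ((Nat.sub_le _ _).trans hj))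
                (norm_nonneg _) (by positivity)
          _ = A * B * (a ^ i * a ^ (j - i)) := by ring
          _ = A * B * a ^ j := by rw [← pow_add, Nat.add_sub_cancel' hij]
    _ = 2 ^ j * (A * B * a ^ j) := by
        rw [← Finset.sum_mul]
        congr 1
        exact_mod_cast Nat.sum_range_choose j
    _ ≤ 2 ^ N * (A * B * a ^ j) := by
        gcongr; norm_num
    _ = _ := by ring

theorem DerivBound.sub {N : ℕ} {a A B : ℝ} {f g : (Fin d → ℝ) → ℂ} {ξ : Fin d → ℝ}
    (hf : DerivBound N a A f ξ) (hg : DerivBound N a B g ξ)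
    (hfc : ContDiff ℝ (N : WithTop ℕ∞) f) (hgc : ContDiff ℝ (N : WithTop ℕ∞) g) :
    DerivBound N a (A + B) (f - g) ξ := by
  intro j hj
  have hj' : ((j : ℕ) : WithTop ℕ∞) ≤ N := by exact_mod_cast hj
  rw [iteratedFDeriv_sub_apply (hfc.of_le hj').contDiffAt (hgc.of_le hj').contDiffAt, add_mul]
  exact (norm_sub_le _ _).trans (add_le_add (hf j hj) (hg j hj))

theorem derivBound_one {N : ℕ} {a : ℝ} (ha : 0 ≤ a) (ξ : Fin d → ℝ) :
    DerivBound N a 1 (1 : (Fin d → ℝ) → ℂ) ξ := by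
  intro j _
  rcases Nat.eq_zero_or_pos j with rfl | hj
  · simp
  · have h : iteratedFDeriv ℝ j (fun _ : Fin d → ℝ => (1 : ℂ)) = 0 :=
      iteratedFDeriv_const_of_ne hj.ne' 1
    change ‖iteratedFDeriv ℝ j (fun _ : Fin d → ℝ => (1 : ℂ)) ξ‖ ≤ _
    rw [h]
    simp; positivity

theorem derivBound_of_eventuallyEq_zero {N : ℕ} {a B : ℝ} {f : (Fin d → ℝ) → ℂ} {ξ : Fin d → ℝ}
    (h : f =ᶠ[nhds ξ] 0) (ha : 0 ≤ a) (hB : 0 ≤ B) : DerivBound N a B f ξ := by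
  intro j _
  rw [(h.iteratedFDeriv ℝ j).eq_of_nhds]
  have h2 : iteratedFDeriv ℝ j (0 : (Fin d → ℝ) → ℂ) = 0 := iteratedFDeriv_zero
  rw [h2]
  simp; positivity

theorem isCompact_cube (R : ℝ) : IsCompact {ξ : Fin d → ℝ | ∀ i, |ξ i| ≤ R} := by
  have : {ξ : Fin d → ℝ | ∀ i, |ξ i| ≤ R} = Set.pi Set.univ fun _ => Set.Icc (-R) R := by
    ext ξ; simp only [Set.mem_ofPred_eq, abs_le, Set.mem_pi, Set.mem_univ, true_implies, Set.mem_Icc]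
  rw [this]
  exact isCompact_univ_pi fun _ => isCompact_Icc

theorem convex_cube (R : ℝ) : Convex ℝ {ξ : Fin d → ℝ | ∀ i, |ξ i| ≤ R} := by
  have : {ξ : Fin d → ℝ | ∀ i, |ξ i| ≤ R} = Set.pi Set.univ fun _ => Set.Icc (-R) R := by
    ext ξ; simp only [Set.mem_ofPred_eq, abs_le, Set.mem_pi, Set.mem_univ, true_implies, Set.mem_Icc]
  rw [this]
  exact convex_pi fun _ _ => convex_Icc _ _

theorem exists_iteratedFDeriv_bound {F : Type*} [NormedAddCommGroup F] [NormedSpace ℝ F] {N : ℕ}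
    {f : (Fin d → ℝ) → F} (hf : ContDiff ℝ (N : WithTop ℕ∞) f) (R : ℝ) :
    ∃ A : ℝ, 1 ≤ A ∧ ∀ j ≤ N, ∀ ξ : Fin d → ℝ, (∀ i, |ξ i| ≤ R) →
      ‖iteratedFDeriv ℝ j f ξ‖ ≤ A := by
  have h : ∀ j : Fin (N + 1), ∃ A : ℝ, ∀ ξ : Fin d → ℝ, (∀ i, |ξ i| ≤ R) →
      ‖iteratedFDeriv ℝ j f ξ‖ ≤ A := fun j =>
    (isCompact_cube R).exists_bound_of_continuousOn
      (hf.continuous_iteratedFDeriv (by exact_mod_cast Nat.lt_succ_iff.1 j.2)).continuousOn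
  choose A hA using h
  refine ⟨1 + ∑ j, |A j|, le_add_of_nonneg_right (Finset.sum_nonneg fun _ _ => abs_nonneg _),
    fun j hj ξ hξ => ?_⟩
  have h1 := hA ⟨j, Nat.lt_succ_iff.2 hj⟩ ξ hξ
  have h2 := Finset.single_le_sum (f := fun j => |A j|) (fun _ _ => abs_nonneg _)
    (Finset.mem_univ (⟨j, Nat.lt_succ_iff.2 hj⟩ : Fin (N + 1)))
  have h3 := le_abs_self (A ⟨j, Nat.lt_succ_iff.2 hj⟩)
  simp only at h1 h2
  linarith

end DerivativeBounds

/-! ### Taylor estimates at the origin -/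

section Taylor

variable {d : ℕ}

/-- Along the segment t ↦ tx the derivative is at most B‖x‖^{m+1} t^m, which is integrated from 0 to
1. -/
theorem norm_le_of_norm_fderiv_le_pow {E G : Type*} [NormedAddCommGroup E] [NormedSpace ℝ E]
    [NormedAddCommGroup G] [NormedSpace ℝ G] {F : E → G} (hF : Differentiable ℝ F) (h0 : F 0 = 0)
    {B ε : ℝ} {m : ℕ} (hB : ∀ x, ‖x‖ ≤ ε → ‖fderiv ℝ F x‖ ≤ B * ‖x‖ ^ m) {x : E} (hx : ‖x‖ ≤ ε) :
    ‖F x‖ ≤ B * ‖x‖ ^ (m + 1) / (m + 1) := by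
  have hf : ∀ t : ℝ, HasDerivAt (fun t : ℝ => F (t • x)) (fderiv ℝ F (t • x) x) t := by
    intro t
    have h1 : HasDerivAt (fun t : ℝ => t • x) x t := by
      simpa using (hasDerivAt_id t).smul_const x
    exact (hF (t • x)).hasFDerivAt.comp_hasDerivAt t h1
  have hb : ∀ t : ℝ, HasDerivAt (fun t : ℝ => B * ‖x‖ ^ (m + 1) * (t ^ (m + 1) / (m + 1)))
      (B * ‖x‖ ^ (m + 1) * t ^ m) t := by
    intro t
    refine HasDerivAt.const_mul _ ?_
    have h1 := (hasDerivAt_pow (m + 1) t).div_const ((m : ℝ) + 1)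
    convert h1 using 1
    push_cast
    field_simp
  have h := image_norm_le_of_norm_deriv_right_le_deriv_boundary (a := 0) (b := 1)
    (f := fun t : ℝ => F (t • x)) (f' := fun t => fderiv ℝ F (t • x) x)
    (fun t _ => (hf t).continuousAt.continuousWithinAt)
    (fun t _ => (hf t).hasDerivWithinAt) (by simp [h0]) hb ?_ (x := 1) (by simp)
  · simpa [div_eq_mul_inv] using h
  · intro t ht
    have hn : ‖t • x‖ = t * ‖x‖ := by rw [norm_smul, Real.norm_eq_abs, abs_of_nonneg ht.1]
    have h1 := hB (t • x) (by rw [hn]; nlinarith [ht.1, ht.2, norm_nonneg x])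
    calc _ ≤ ‖fderiv ℝ F (t • x)‖ * ‖x‖ := ContinuousLinearMap.le_opNorm _ _
      _ ≤ (B * ‖t • x‖ ^ m) * ‖x‖ := by gcongr
      _ = _ := by rw [hn]; ring

/-- Taylor's estimate for all derivatives of a function vanishing to order `r` at the origin. -/
theorem norm_iteratedFDeriv_le_of_vanishing {E G : Type*} [NormedAddCommGroup E] [NormedSpace ℝ E]
    [NormedAddCommGroup G] [NormedSpace ℝ G] {h : E → G} {r : ℕ}
    (hc : ContDiff ℝ ((r + 1 : ℕ) : WithTop ℕ∞) h) (h0 : ∀ n ≤ r, iteratedFDeriv ℝ n h 0 = 0)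
    {T ε : ℝ} (hT : ∀ x, ‖x‖ ≤ ε → ‖iteratedFDeriv ℝ (r + 1) h x‖ ≤ T) (m : ℕ) :
    ∀ j, j + m = r + 1 → ∀ x, ‖x‖ ≤ ε →
      ‖iteratedFDeriv ℝ j h x‖ ≤ T / (m.factorial : ℝ) * ‖x‖ ^ m := by
  -- Descent from order r + 1: each integration along a ray raises the power of ‖x‖ by one and
  -- divides by it, which produces m!.
  induction m with
  | zero =>
    intro j hj x hx
    obtain rfl : j = r + 1 := by omega
    simpa using hT x hx
  | succ m ih =>
    intro j hj x hx
    have h1 := norm_le_of_norm_fderiv_le_pow (F := iteratedFDeriv ℝ j h)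
      (hc.differentiable_iteratedFDeriv (by exact_mod_cast (by omega : j < r + 1)))
      (h0 j (by omega)) (B := T / (m.factorial : ℝ)) (ε := ε) (m := m)
      (fun y hy => by rw [norm_fderiv_iteratedFDeriv]; exact ih (j + 1) (by omega) y hy) hx
    refine h1.trans (le_of_eq ?_)
    rw [Nat.factorial_succ]
    push_cast
    field_simp

/-- Multilinear expansion over the d^n tuples of basis vectors. It converts the coordinate
derivatives in β into operator norms. -/
theorem opNorm_le_of_apply_single_le {n : ℕ}
    (T : ContinuousMultilinearMap ℝ (fun _ : Fin n => Fin d → ℝ) ℂ) {β : ℝ} (hβ0 : 0 ≤ β)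
    (hβ : ∀ s : Fin n → Fin d, ‖T fun j => Pi.single (s j) 1‖ ≤ β) : ‖T‖ ≤ d ^ n * β := by
  refine ContinuousMultilinearMap.opNorm_le_bound (by positivity) fun v => ?_
  have hv : v = fun j => ∑ i, v j i • (Pi.single i 1 : Fin d → ℝ) := by
    ext j i; simp [Finset.sum_apply, Pi.single_apply]
  have h1 : T v = ∑ s : Fin n → Fin d, (∏ j, v j (s j)) • T fun j => Pi.single (s j) 1 := by
    conv_lhs => rw [hv]
    rw [ContinuousMultilinearMap.map_sum]
    exact Finset.sum_congr rfl fun s _ => ContinuousMultilinearMap.map_smul_univ _ _ _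
  rw [h1]
  calc _ ≤ ∑ _s : Fin n → Fin d, (∏ j, ‖v j‖) * β := by
        refine norm_sum_le_of_le _ fun s _ => ?_
        rw [norm_smul, norm_prod]
        refine mul_le_mul (Finset.prod_le_prod (fun _ _ => norm_nonneg _)
          fun j _ => norm_le_pi_norm (v j) (s j)) (hβ s) (norm_nonneg _)
          (Finset.prod_nonneg fun _ _ => norm_nonneg _)
    _ = _ := by
        simp only [Finset.sum_const, Finset.card_univ, Fintype.card_pi, Fintype.card_fin,
          Finset.prod_const, nsmul_eq_mul]
        push_cast; ring

theorem bddAbove_betaSup {n : ℕ} {f : (Fin d → ℝ) → ℂ}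
    (hf : ContDiff ℝ (n : WithTop ℕ∞) f) (ε : ℝ) :
    BddAbove {x : ℝ | ∃ (s : Fin n → Fin d) (ξ : Fin d → ℝ),
      (∀ i, |ξ i| ≤ ε) ∧ x = ‖partialDeriv s f ξ‖} := by
  obtain ⟨A, -, hA⟩ := exists_iteratedFDeriv_bound hf ε
  refine ⟨A, ?_⟩
  rintro x ⟨s, ξ, hξ, rfl⟩
  refine (ContinuousMultilinearMap.le_opNorm _ _).trans ?_
  simpa [Pi.norm_single] using hA n le_rfl ξ hξ

theorem betaSup_nonneg (n : ℕ) (f : (Fin d → ℝ) → ℂ) (ε : ℝ) : 0 ≤ betaSup n f ε := by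
  refine Real.sSup_nonneg ?_
  rintro x ⟨s, ξ, -, rfl⟩
  exact norm_nonneg _

theorem betaSup_mono {n : ℕ} {f : (Fin d → ℝ) → ℂ} (hf : ContDiff ℝ (n : WithTop ℕ∞) f)
    {ε ε' : ℝ} (h : ε ≤ ε') : betaSup n f ε ≤ betaSup n f ε' := by
  refine Real.sSup_le ?_ (betaSup_nonneg n f ε')
  rintro x ⟨s, ξ, hξ, rfl⟩
  exact le_csSup (bddAbove_betaSup hf ε') ⟨s, ξ, fun i => (hξ i).trans h, rfl⟩

/-- With j + m = r + 1, the Taylor bound of order j carries ε^m = ε^{r+1}(1/ε)^j, hence frequency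
1/ε. The factor d^{r+1}/m! = d^j · d^m/m! is at most d^k e^d, which keeps the constant independent
of r. -/
theorem derivBound_of_taylor (hd : 1 ≤ d) {h : (Fin d → ℝ) → ℂ} {r k : ℕ} (hk : k ≤ r + 1)
    (hc : ContDiff ℝ ((r + 1 : ℕ) : WithTop ℕ∞) h)
    (h0 : ∀ n : ℕ, n ≤ r → ∀ s : Fin n → Fin d, partialDeriv s h 0 = 0) {ε : ℝ} (hε : 0 < ε)
    {ξ : Fin d → ℝ} (hξ : ∀ i, |ξ i| ≤ ε) :
    DerivBound k (1 / ε) (d ^ k * Real.exp d * (ε ^ (r + 1) * betaSup (r + 1) h ε)) h ξ := by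
  have hβ := betaSup_nonneg (r + 1) h ε
  have hz : ∀ n ≤ r, iteratedFDeriv ℝ n h 0 = 0 := by
    intro n hn
    have := opNorm_le_of_apply_single_le (iteratedFDeriv ℝ n h 0) le_rfl
      (fun s => (norm_eq_zero.2 (h0 n hn s)).le)
    rw [mul_zero] at this
    exact norm_le_zero_iff.1 this
  have hT : ∀ x : Fin d → ℝ, ‖x‖ ≤ ε → ‖iteratedFDeriv ℝ (r + 1) h x‖ ≤
      d ^ (r + 1) * betaSup (r + 1) h ε := by
    intro x hx
    refine opNorm_le_of_apply_single_le _ hβ fun s => ?_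
    exact le_csSup (bddAbove_betaSup hc ε) ⟨s, x, fun i => (norm_le_pi_norm x i).trans hx, rfl⟩
  have hξn : ‖ξ‖ ≤ ε := (pi_norm_le_iff_of_nonneg hε.le).2 hξ
  have hd' : (1 : ℝ) ≤ d := by exact_mod_cast hd
  intro j hj
  obtain ⟨m, hm⟩ : ∃ m, j + m = r + 1 := ⟨r + 1 - j, by omega⟩
  have h1 := norm_iteratedFDeriv_le_of_vanishing hc hz hT m j hm ξ hξn
  refine h1.trans ?_
  have h2 : (d : ℝ) ^ m / (m.factorial : ℝ) ≤ Real.exp d :=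
    Real.pow_div_factorial_le_exp _ (by positivity) m
  have h3 : (d : ℝ) ^ j ≤ d ^ k := pow_le_pow_right₀ hd' hj
  calc (d : ℝ) ^ (r + 1) * betaSup (r + 1) h ε / (m.factorial : ℝ) * ‖ξ‖ ^ m
      ≤ (d : ℝ) ^ (r + 1) * betaSup (r + 1) h ε / (m.factorial : ℝ) * ε ^ m := by gcongr
    _ = (d : ℝ) ^ j * ((d : ℝ) ^ m / (m.factorial : ℝ)) * (ε ^ m * betaSup (r + 1) h ε) := by
        rw [← hm, pow_add]; ring
    _ ≤ (d : ℝ) ^ k * Real.exp d * (ε ^ m * betaSup (r + 1) h ε) := by gcongr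
    _ = _ := by
        rw [show ε ^ (r + 1) = ε ^ j * ε ^ m by rw [← pow_add, hm], one_div, inv_pow]
        field_simp

end Taylor

/-! ### Smooth periodic cutoffs -/

section Cutoff

variable {d : ℕ}

/-- The profile of the cutoff functions, supported in the cube of radius `15/16`. -/
def cutoffProfile (t : Fin d → ℝ) : ℂ :=
  ∏ l, ((Real.smoothTransition ((225 - 256 * t l ^ 2) / 81) : ℝ) : ℂ)

theorem contDiff_cutoffProfile (N : ℕ) :
    ContDiff ℝ (N : WithTop ℕ∞) (cutoffProfile (d := d)) := by
  unfold cutoffProfile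
  refine contDiff_prod fun l _ => Complex.ofRealCLM.contDiff.comp ?_
  refine (Real.smoothTransition.contDiff (n := (N : ℕ∞))).comp ?_
  exact ((contDiff_const.sub (contDiff_const.mul ((contDiff_apply ℝ ℝ l).pow 2))).div_const _)

/-- The argument (225 − 256t²)/81 of the smooth transition is 0 at |t| = 15/16 and 1 at |t| = 3/4.
-/
theorem cutoffProfile_eq_zero {t : Fin d → ℝ} {l : Fin d} (h : 15 / 16 ≤ |t l|) :
    cutoffProfile t = 0 := by
  refine Finset.prod_eq_zero (Finset.mem_univ l) ?_
  rw [Real.smoothTransition.zero_of_nonpos, Complex.ofReal_zero]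
  have : (15 / 16 : ℝ) ^ 2 ≤ t l ^ 2 := by rw [← sq_abs (t l)]; gcongr
  linarith

theorem cutoffProfile_eq_one {t : Fin d → ℝ} (h : ∀ l, |t l| ≤ 3 / 4) : cutoffProfile t = 1 := by
  refine Finset.prod_eq_one fun l _ => ?_
  rw [Real.smoothTransition.one_of_one_le, Complex.ofReal_one]
  have : t l ^ 2 ≤ (3 / 4 : ℝ) ^ 2 := by rw [← sq_abs (t l)]; gcongr; exact h l
  linarith

theorem hasCompactSupport_cutoffProfile : HasCompactSupport (cutoffProfile (d := d)) := by
  refine HasCompactSupport.intro (isCompact_cube (d := d) 1) fun t ht => ?_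
  simp only [Set.mem_ofPred_eq, not_forall, not_le] at ht
  obtain ⟨l, hl⟩ := ht
  exact cutoffProfile_eq_zero (l := l) (by linarith)

/-- The periodic function `2 sin(ξ/2)`, which is close to `ξ` near the origin. -/
def halfSine (ξ : Fin d → ℝ) : Fin d → ℝ := fun l => 2 * Real.sin (ξ l / 2)

theorem contDiff_halfSine (N : WithTop ℕ∞) : ContDiff ℝ N (halfSine (d := d)) := by
  rw [contDiff_pi]
  intro l
  exact contDiff_const.mul (Real.contDiff_sin.comp ((contDiff_apply ℝ ℝ l).div_const 2))

/-- A smooth periodic cutoff to the cube of radius `ε` about the origin. -/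
def cutoff (ε : ℝ) (ξ : Fin d → ℝ) : ℂ := cutoffProfile (ε⁻¹ • halfSine ξ)

theorem contDiff_cutoff (ε : ℝ) (N : ℕ) : ContDiff ℝ (N : WithTop ℕ∞) (cutoff (d := d) ε) :=
  (contDiff_cutoffProfile N).comp ((contDiff_halfSine _).const_smul ε⁻¹)

/-- Under a period sin(ξ/2) only changes sign, and the profile is even in each coordinate. -/
theorem torusPeriodic_cutoff (ε : ℝ) : TorusPeriodic (cutoff (d := d) ε) := by
  intro ξ i
  unfold cutoff cutoffProfile
  refine Finset.prod_congr rfl fun l _ => ?_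
  have h : halfSine (ξ + Pi.single i (2 * Real.pi)) l ^ 2 = halfSine ξ l ^ 2 := by
    by_cases hl : l = i
    · subst hl
      simp only [halfSine, Pi.add_apply, Pi.single_eq_same]
      rw [show (ξ l + 2 * Real.pi) / 2 = ξ l / 2 + Real.pi by ring, Real.sin_add_pi]
      ring
    · simp [halfSine, hl]
  simp only [Pi.smul_apply, smul_eq_mul, mul_pow, h]

theorem cutoff_eq_one {ε : ℝ} (hε : 0 < ε) {ξ : Fin d → ℝ} (h : ∀ l, |ξ l| ≤ 3 / 4 * ε) :
    cutoff ε ξ = 1 := by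
  refine cutoffProfile_eq_one fun l => ?_
  have h1 : |Real.sin (ξ l / 2)| ≤ |ξ l / 2| := Real.abs_sin_le_abs
  rw [abs_div, abs_two] at h1
  simp only [halfSine, Pi.smul_apply, smul_eq_mul, abs_mul, abs_two, abs_inv, abs_of_pos hε]
  rw [inv_mul_le_iff₀ hε]
  have := h l
  linarith

/-- For ε < 1 the cubic lower bound for the sine gives 2 sin(ε/2) > 15ε/16, whence the radius of the
profile. Vanishing on a neighbourhood kills all derivatives as well. -/
theorem cutoff_eventuallyEq_zero {ε : ℝ} (hε : 0 < ε) (hε1 : ε < 1) {ξ : Fin d → ℝ} {l : Fin d}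
    (hl : ε < |ξ l|) (hl2 : |ξ l| ≤ Real.pi) : cutoff (d := d) ε =ᶠ[nhds ξ] 0 := by
  have hpi := Real.pi_pos
  have h1 : 15 / 16 * ε < |halfSine ξ l| := by
    have h2 : |Real.sin (ξ l / 2)| = Real.sin (|ξ l| / 2) := by
      rw [Real.abs_sin_eq_sin_abs_of_abs_le_pi, abs_div, abs_two]
      rw [abs_div, abs_two]; linarith
    have h3 : Real.sin (ε / 2) ≤ Real.sin (|ξ l| / 2) :=
      Real.sin_le_sin_of_le_of_le_pi_div_two (by linarith) (by linarith) (by linarith)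
    have h4 := Real.sin_gt_sub_cube (x := ε / 2) (by linarith)
    rw [halfSine, abs_mul, abs_two, h2]
    nlinarith [mul_pos hε hε, mul_pos (mul_pos hε hε) hε]
  have h5 : ∀ᶠ η in nhds ξ, 15 / 16 * ε < |halfSine η l| := by
    have hc : Continuous fun η : Fin d → ℝ => |halfSine η l| :=
      (continuous_apply l |>.comp (contDiff_halfSine (d := d) 0).continuous).abs
    exact hc.continuousAt.eventually (lt_mem_nhds h1)
  filter_upwards [h5] with η hη
  refine cutoffProfile_eq_zero (l := l) ?_
  simp only [Pi.smul_apply, smul_eq_mul, abs_mul, abs_inv, abs_of_pos hε]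
  rw [le_inv_mul_iff₀ hε]
  linarith

/-- Higher chain rule: every derivative of the inner map is at most A/ε, and A/ε ≥ 1 allows this to
be replaced by (A/ε)^i, as the rule requires. -/
theorem exists_derivBound_cutoff (N : ℕ) : ∃ C : ℝ, 1 ≤ C ∧ ∀ ε : ℝ, 0 < ε → ε < 1 →
    ∀ ξ : Fin d → ℝ, (∀ i, |ξ i| ≤ Real.pi) → DerivBound N (1 / ε) C (cutoff ε) ξ := by
  obtain ⟨A, hA1, hA⟩ := exists_iteratedFDeriv_bound (d := d)
    (contDiff_halfSine (N : WithTop ℕ∞)) Real.pi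
  have h : ∀ j : Fin (N + 1), ∃ B : ℝ, ∀ t : Fin d → ℝ,
      ‖iteratedFDeriv ℝ j (cutoffProfile (d := d)) t‖ ≤ B := fun j =>
    ((contDiff_cutoffProfile N).continuous_iteratedFDeriv
      (by exact_mod_cast Nat.lt_succ_iff.1 j.2)).bounded_above_of_compact_support
      (hasCompactSupport_cutoffProfile.iteratedFDeriv j)
  choose B hB using h
  have hS : 0 ≤ ∑ j, |B j| := Finset.sum_nonneg fun _ _ => abs_nonneg _
  have hB' : ∀ j ≤ N, ∀ t : Fin d → ℝ,
      ‖iteratedFDeriv ℝ j (cutoffProfile (d := d)) t‖ ≤ 1 + ∑ j, |B j| := by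
    intro j hj t
    have h1 := hB ⟨j, Nat.lt_succ_iff.2 hj⟩ t
    have h2 := Finset.single_le_sum (f := fun j => |B j|) (fun _ _ => abs_nonneg _)
      (Finset.mem_univ (⟨j, Nat.lt_succ_iff.2 hj⟩ : Fin (N + 1)))
    have h3 := le_abs_self (B ⟨j, Nat.lt_succ_iff.2 hj⟩)
    simp only at h1 h2
    linarith
  have hfac : (1 : ℝ) ≤ N.factorial := by exact_mod_cast Nat.factorial_pos N
  refine ⟨N.factorial * (1 + ∑ j, |B j|) * A ^ N, ?_, fun ε hε hε1 ξ hξ j hj => ?_⟩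
  · exact one_le_mul_of_one_le_of_one_le
      (one_le_mul_of_one_le_of_one_le hfac (by linarith)) (one_le_pow₀ hA1)
  · have hj' : ((j : ℕ) : WithTop ℕ∞) ≤ N := by exact_mod_cast hj
    have hinv : 1 ≤ ε⁻¹ := (one_le_inv₀ hε).2 hε1.le
    have h := norm_iteratedFDeriv_comp_le (𝕜 := ℝ) (g := cutoffProfile (d := d))
      (f := fun ξ => ε⁻¹ • halfSine ξ) (n := j) (N := N)
      (contDiff_cutoffProfile N) ((contDiff_halfSine _).const_smul ε⁻¹) hj' ξ
      (C := 1 + ∑ j, |B j|) (D := A * ε⁻¹)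
      (fun i hi => hB' i (hi.trans hj) _) ?_
    · refine le_trans h ?_
      have hAj : A ^ j ≤ A ^ N := pow_le_pow_right₀ hA1 hj
      have hfj : (j.factorial : ℝ) ≤ N.factorial := by exact_mod_cast Nat.factorial_le hj
      rw [mul_pow, one_div, ← mul_assoc]
      gcongr
    · intro i hi1 hi
      have hi' : ((i : ℕ) : WithTop ℕ∞) ≤ N := by exact_mod_cast hi.trans hj
      rw [iteratedFDeriv_const_smul_apply' (contDiff_halfSine _).contDiffAt, norm_smul,
        Real.norm_eq_abs, abs_of_pos (by positivity)]
      calc ε⁻¹ * ‖iteratedFDeriv ℝ i halfSine ξ‖ ≤ ε⁻¹ * A := by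
            gcongr; exact hA i (hi.trans hj) ξ hξ
        _ = (A * ε⁻¹) := mul_comm _ _
        _ ≤ (A * ε⁻¹) ^ i := le_self_pow₀ (one_le_mul_of_one_le_of_one_le hA1 hinv) (by omega)

end Cutoff

/-! ### Gaussian bounds for the exponential of the phase -/

section ExponentBounds

variable {d : ℕ} {φ : Fin d → ℝ → ℂ}

theorem norm_iteratedFDeriv_cexp_le (j : ℕ) (z : ℂ) :
    ‖iteratedFDeriv ℝ j Complex.exp z‖ ≤ Real.exp z.re := by
  have h := ContDiffAt.restrictScalars_iteratedFDeriv (𝕜 := ℝ) (𝕜' := ℂ) (n := j)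
    (Complex.contDiff_exp (n := (j : WithTop ℕ∞))).contDiffAt (x := z)
  rw [← h, Function.comp_apply, ContinuousMultilinearMap.norm_restrictScalars,
    norm_iteratedFDeriv_eq_norm_iteratedDeriv, iteratedDeriv_eq_iterate, Complex.iter_deriv_exp,
    Complex.norm_exp]

theorem contDiff_sumExponent {N : WithTop ℕ∞} (hφ : ∀ i, ContDiff ℝ N (φ i)) :
    ContDiff ℝ N (sumExponent φ) := by
  unfold sumExponent
  exact ContDiff.sum fun i _ => (hφ i).comp (contDiff_apply ℝ ℝ i)

/-- The linear form `ξ ↦ i⟨n,ξ⟩`. -/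
def frequencyForm (n : Fin d → ℤ) : (Fin d → ℝ) →L[ℝ] ℂ :=
  Complex.I • ∑ j, (n j : ℂ) •
    (Complex.ofRealCLM.comp (ContinuousLinearMap.proj (R := ℝ) (φ := fun _ : Fin d => ℝ) j))

theorem frequencyForm_apply (n : Fin d → ℤ) (ξ : Fin d → ℝ) :
    frequencyForm n ξ = Complex.I * ∑ j, (n j : ℂ) * (ξ j : ℂ) := by
  simp [frequencyForm]

/-- The exponent `lam φ` with the integral frequency `n` removed. -/
def phase (φ : Fin d → ℝ → ℂ) (lam : ℝ) (n : Fin d → ℤ) (ξ : Fin d → ℝ) : ℂ :=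
  lam • sumExponent φ ξ - frequencyForm n ξ

theorem exp_phase (lam : ℝ) (n : Fin d → ℤ) (ξ : Fin d → ℝ) :
    Complex.exp (phase φ lam n ξ) =
      Complex.exp ((lam : ℂ) * sumExponent φ ξ) * character (-n) ξ := by
  rw [phase, frequencyForm_apply, sub_eq_add_neg, Complex.exp_add, character_neg,
    Complex.real_smul]

theorem contDiff_phase {N : WithTop ℕ∞} (hφ : ∀ i, ContDiff ℝ N (φ i)) (lam : ℝ)
    (n : Fin d → ℤ) : ContDiff ℝ N (phase φ lam n) :=
  ((contDiff_sumExponent hφ).const_smul lam).sub (frequencyForm n).contDiff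

/-- From order two on the linear form drops out, so removing a frequency affects only the phase and
its first derivative. -/
theorem iteratedFDeriv_phase {N : ℕ} (hφ : ∀ i, ContDiff ℝ (N : WithTop ℕ∞) (φ i)) (lam : ℝ)
    (n : Fin d → ℤ) {j : ℕ} (hj : j ≤ N) (hj2 : 2 ≤ j) (ξ : Fin d → ℝ) :
    ‖iteratedFDeriv ℝ j (phase φ lam n) ξ‖ =
      |lam| * ‖iteratedFDeriv ℝ j (sumExponent φ) ξ‖ := by
  have hj' : ((j : ℕ) : WithTop ℕ∞) ≤ N := by exact_mod_cast hj
  have hs : ContDiff ℝ (j : WithTop ℕ∞) (sumExponent φ) := (contDiff_sumExponent hφ).of_le hj'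
  have h1 : iteratedFDeriv ℝ j (frequencyForm n) ξ = 0 := by
    obtain ⟨i, rfl⟩ : ∃ i, j = i + 1 := ⟨j - 1, by omega⟩
    rw [← norm_eq_zero, ← norm_iteratedFDeriv_fderiv]
    have h2 : fderiv ℝ (frequencyForm n) = fun _ => frequencyForm n :=
      funext fun x => (frequencyForm n).fderiv
    rw [h2, iteratedFDeriv_const_of_ne (by omega)]
    simp
  have h3 : phase φ lam n = (fun ξ => lam • sumExponent φ ξ) - (frequencyForm n) := rfl
  rw [h3, iteratedFDeriv_sub_apply (hs.const_smul lam).contDiffAt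
    (frequencyForm n).contDiff.contDiffAt, h1, sub_zero,
    iteratedFDeriv_const_smul_apply' hs.contDiffAt, norm_smul, Real.norm_eq_abs]

/-- The real part is maximal at 0. Hence the drift is purely imaginary, the only kind a character
can cancel. -/
theorem re_deriv_eq_zero {f : ℝ → ℂ} (hf : Differentiable ℝ f) (h0 : f 0 = 0)
    (hre : ∀ θ, (f θ).re ≤ 0) : (deriv f 0).re = 0 := by
  have h1 : HasDerivAt (fun θ => (f θ).re) (deriv f 0).re 0 :=
    Complex.reCLM.hasFDerivAt.comp_hasDerivAt (0 : ℝ) (hf 0).hasDerivAt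
  refine IsLocalMax.hasDerivAt_eq_zero (f := fun θ => (f θ).re) ?_ h1
  refine Filter.Eventually.of_forall fun θ => ?_
  simpa [h0] using hre θ

/-- An integral frequency can be removed so as to make the phase almost stationary at `0`. -/
theorem exists_norm_fderiv_phase_le (hφ : ∀ i, Differentiable ℝ (φ i)) (h0 : ∀ i, φ i 0 = 0)
    (hre : ∀ i θ, (φ i θ).re ≤ 0) (lam : ℝ) :
    ∃ n : Fin d → ℤ, ‖fderiv ℝ (phase φ lam n) 0‖ ≤ d := by
  -- The integer nearest to λmᵢ leaves a remainder of at most 1/2 in each coordinate.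
  refine ⟨fun i => round (lam * (deriv (φ i) 0).im), ?_⟩
  set n : Fin d → ℤ := fun i => round (lam * (deriv (φ i) 0).im) with hn
  have h1 : HasFDerivAt (sumExponent φ) (∑ i, (ContinuousLinearMap.proj (R := ℝ)
      (φ := fun _ : Fin d => ℝ) i).smulRight (deriv (φ i) 0)) 0 := by
    unfold sumExponent
    refine HasFDerivAt.fun_sum fun i _ => ?_
    have h2 : HasDerivAt (φ i) (deriv (φ i) 0) ((0 : Fin d → ℝ) i) := (hφ i 0).hasDerivAt
    have h3 := h2.hasFDerivAt.comp (0 : Fin d → ℝ)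
      (ContinuousLinearMap.proj (R := ℝ) (φ := fun _ : Fin d => ℝ) i).hasFDerivAt
    refine h3.congr_fderiv ?_
    ext v
    simp
  have h2 : HasFDerivAt (phase φ lam n) _ 0 := (h1.const_smul lam).sub (frequencyForm n).hasFDerivAt
  rw [h2.fderiv]
  refine ContinuousLinearMap.opNorm_le_bound _ (by positivity) fun v => ?_
  have h3 : ∀ i, lam * deriv (φ i) 0 - Complex.I * n i =
      Complex.I * ((lam * (deriv (φ i) 0).im - n i : ℝ) : ℂ) := by
    intro i
    have h4 : deriv (φ i) 0 = ((deriv (φ i) 0).im : ℂ) * Complex.I := by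
      apply Complex.ext
      · simp [re_deriv_eq_zero (hφ i) (h0 i) (hre i)]
      · simp
    conv_lhs => rw [h4]
    push_cast; ring
  have h5 : (lam • (∑ i, (ContinuousLinearMap.proj (R := ℝ)
      (φ := fun _ : Fin d => ℝ) i).smulRight (deriv (φ i) 0)) - frequencyForm n) v =
      ∑ i, (v i : ℂ) * (Complex.I * ((lam * (deriv (φ i) 0).im - n i : ℝ) : ℂ)) := by
    simp only [sub_apply, smul_apply, sum_apply, ContinuousLinearMap.smulRight_apply,
      ContinuousLinearMap.proj_apply, frequencyForm_apply, Complex.real_smul, ← h3,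
      Finset.mul_sum, ← Finset.sum_sub_distrib]
    exact Finset.sum_congr rfl fun i _ => by ring
  rw [h5]
  calc _ ≤ ∑ _i : Fin d, ‖v‖ := by
        refine norm_sum_le_of_le _ fun i _ => ?_
        rw [norm_mul, norm_mul, Complex.norm_I, one_mul, Complex.norm_real, Complex.norm_real]
        have h6 := abs_sub_round (lam * (deriv (φ i) 0).im)
        have h7 := norm_le_pi_norm v i
        simp only [Real.norm_eq_abs, hn] at h7 ⊢
        nlinarith [abs_nonneg (v i), abs_nonneg (lam * (deriv (φ i) 0).im -
          round (lam * (deriv (φ i) 0).im))]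
    _ = _ := by simp

/-- By u ≤ e^u the power becomes an exponential of a linear function of t, and the square is
completed. It absorbs polynomial growth in √λ‖ξ‖ into a part of the Gaussian. -/
theorem add_pow_mul_exp_le {b c t : ℝ} (hb : 0 ≤ b) (hc : 0 < c) (ht : 0 ≤ t) {j k : ℕ}
    (hjk : j ≤ k) : (b + t) ^ j * Real.exp (-(c * t ^ 2)) ≤ Real.exp (k * b + k ^ 2 / (4 * c)) := by
  have h1 : b + t ≤ Real.exp (b + t) := by linarith [Real.add_one_le_exp (b + t)]
  have h2 : (b + t) ^ j ≤ Real.exp (k * (b + t)) := by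
    calc (b + t) ^ j ≤ Real.exp (b + t) ^ j := pow_le_pow_left₀ (by positivity) h1 j
      _ = Real.exp (j * (b + t)) := by rw [← Real.exp_nat_mul]
      _ ≤ _ := by
        have : (j : ℝ) ≤ k := by exact_mod_cast hjk
        gcongr
  calc _ ≤ Real.exp (k * (b + t)) * Real.exp (-(c * t ^ 2)) := by gcongr
    _ = Real.exp (k * (b + t) - c * t ^ 2) := by rw [← Real.exp_add]; ring_nf
    _ ≤ _ := by
      refine Real.exp_le_exp.2 ?_
      have h3 : (k : ℝ) ^ 2 / (4 * c) = k * t - c * t ^ 2 + (2 * c * t - k) ^ 2 / (4 * c) := by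
        field_simp; ring
      have h4 : 0 ≤ (2 * c * t - (k : ℝ)) ^ 2 / (4 * c) := by positivity
      linarith

/-- Gaussian bounds for the derivatives of `exp(lam φ)`, after removal of an integral frequency. -/
theorem exists_derivBound_exp_phase {k : ℕ} {M : ℝ} (hM : 0 < M)
    (hφ : ∀ i, ContDiff ℝ ((max 2 k : ℕ) : WithTop ℕ∞) (φ i)) (h0 : ∀ i, φ i 0 = 0)
    (hre0 : ∀ i θ, (φ i θ).re ≤ 0)
    (hre : ∀ i θ, |θ| ≤ Real.pi → (φ i θ).re ≤ -(M * θ ^ 2)) :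
    ∃ C : ℝ, 0 < C ∧ ∀ lam : ℝ, 0 < lam → ∃ n : Fin d → ℤ, ∀ ξ : Fin d → ℝ,
      (∀ i, |ξ i| ≤ Real.pi) → DerivBound k (1 + √lam)
        (C * Real.exp (-(8 / 9 * lam * M * ∑ i, ξ i ^ 2)))
        (fun ξ => Complex.exp (phase φ lam n ξ)) ξ := by
  have hpi := Real.pi_pos
  obtain ⟨A, hA1, hA⟩ := exists_iteratedFDeriv_bound (contDiff_sumExponent hφ) Real.pi
  set A' : ℝ := A + d with hA'
  have hA'1 : 1 ≤ A' := le_add_of_le_of_nonneg hA1 (Nat.cast_nonneg d)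
  refine ⟨k.factorial * A' ^ k * Real.exp (k * (1 + Real.pi) + k ^ 2 / (4 * (M / 9))),
    by positivity, fun lam hlam => ?_⟩
  obtain ⟨n, hn⟩ := exists_norm_fderiv_phase_le
    (fun i => (hφ i).differentiable (by norm_cast; omega)) h0 hre0 lam
  refine ⟨n, fun ξ hξ j hj => ?_⟩
  set s := √lam with hs
  have hs0 : 0 < s := Real.sqrt_pos.2 hlam
  have hs2 : s ^ 2 = lam := Real.sq_sqrt hlam.le
  have hph := contDiff_phase hφ lam n
  have hξπ : ‖ξ‖ ≤ Real.pi := (pi_norm_le_iff_of_nonneg hpi.le).2 hξ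
  have hξ0 := norm_nonneg ξ
  -- D^i must dominate the i-th derivative of the phase: d + λA‖ξ‖ for i = 1, by the mean value
  -- inequality from 0, and λA for i ≥ 2. The last factor of D handles the growth in ‖ξ‖.
  set D : ℝ := A' * (1 + s) * (1 + Real.pi + s * ‖ξ‖) with hD
  have hD1 : 1 + s ≤ D / A' := by
    rw [hD, mul_assoc, mul_div_cancel_left₀ _ (by positivity)]
    exact le_mul_of_one_le_right (by positivity) (by nlinarith)
  have hD2 : ∀ i, 1 ≤ i → i ≤ j → ‖iteratedFDeriv ℝ i (phase φ lam n) ξ‖ ≤ D ^ i := by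
    intro i hi1 hij
    rcases Nat.lt_or_ge i 2 with hi2 | hi2
    · obtain rfl : i = 1 := by omega
      have h1 : ‖iteratedFDeriv ℝ 1 (phase φ lam n) ξ - iteratedFDeriv ℝ 1 (phase φ lam n) 0‖ ≤
          lam * A * ‖ξ - 0‖ := by
        refine (convex_cube Real.pi).norm_image_sub_le_of_norm_fderiv_le (𝕜 := ℝ)
          (fun x _ => hph.differentiable_iteratedFDeriv (m := 1) (by norm_cast; omega) x)
          (fun x hx => ?_) (fun i => by simp [hpi.le]) hξ
        rw [norm_fderiv_iteratedFDeriv, iteratedFDeriv_phase hφ lam n (by omega) le_rfl,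
          abs_of_pos hlam]
        gcongr
        exact hA 2 (by omega) x hx
      have h2 : ‖iteratedFDeriv ℝ 1 (phase φ lam n) 0‖ ≤ d := by
        rw [norm_iteratedFDeriv_one]; exact hn
      have h3 := norm_sub_norm_le (iteratedFDeriv ℝ 1 (phase φ lam n) ξ)
        (iteratedFDeriv ℝ 1 (phase φ lam n) 0)
      rw [sub_zero] at h1
      have h4 : (d : ℝ) + lam * A * ‖ξ‖ ≤ D := by
        rw [hD, hA', ← hs2]
        have hd0 : (0 : ℝ) ≤ d := Nat.cast_nonneg d
        have e1 : (d : ℝ) * 1 ≤ (A + d) * ((1 + s) * (1 + Real.pi)) := by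
          refine mul_le_mul (by linarith) (by nlinarith) zero_le_one (by positivity)
        have e2 : A * (s * (s * ‖ξ‖)) ≤ (A + d) * ((1 + s) * (s * ‖ξ‖)) := by
          gcongr <;> linarith
        nlinarith
      rw [pow_one]
      linarith
    · rw [iteratedFDeriv_phase hφ lam n (by omega) hi2, abs_of_pos hlam]
      have h1 : lam * ‖iteratedFDeriv ℝ i (sumExponent φ) ξ‖ ≤ lam * A := by
        gcongr; exact hA i (by omega) ξ hξ
      have h2 : A' * (1 + s) ≤ D := by
        rw [le_div_iff₀ (by positivity)] at hD1; linarith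
      have h3 : (A' * (1 + s)) ^ 2 ≤ (A' * (1 + s)) ^ i :=
        pow_le_pow_right₀ (one_le_mul_of_one_le_of_one_le hA'1 (by linarith)) hi2
      have h4 : lam * A ≤ (A' * (1 + s)) ^ 2 := by
        rw [mul_pow, mul_comm, ← hs2]
        have hAA : A ≤ A' ^ 2 := by
          have : A ≤ A' := le_add_of_nonneg_right (Nat.cast_nonneg d)
          nlinarith
        gcongr; linarith
      have h5 : (A' * (1 + s)) ^ i ≤ D ^ i := pow_le_pow_left₀ (by positivity) h2 i
      linarith
  have hj' : ((j : ℕ) : WithTop ℕ∞) ≤ ((max 2 k : ℕ) : WithTop ℕ∞) := by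
    norm_cast; omega
  have hmain := norm_iteratedFDeriv_comp_le (𝕜 := ℝ) (g := Complex.exp) (f := phase φ lam n)
    (n := j) (N := ((max 2 k : ℕ) : WithTop ℕ∞)) Complex.contDiff_exp hph hj' ξ
    (C := Real.exp (phase φ lam n ξ).re) (fun i _ => norm_iteratedFDeriv_cexp_le i _) hD2
  have hreph : (phase φ lam n ξ).re ≤ -(lam * M * ∑ i, ξ i ^ 2) := by
    have h1 : (frequencyForm n ξ).re = 0 := by
      rw [frequencyForm_apply, Complex.I_mul_re, neg_eq_zero, Complex.im_sum]
      exact Finset.sum_eq_zero fun i _ => by simp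
    rw [phase, Complex.sub_re, h1, sub_zero, Complex.real_smul, Complex.re_ofReal_mul,
      sumExponent, Complex.re_sum]
    calc lam * ∑ i, (φ i (ξ i)).re ≤ lam * ∑ i, -(M * ξ i ^ 2) := by
          gcongr with i; exact hre i _ (hξ i)
      _ = _ := by rw [Finset.sum_neg_distrib, ← Finset.mul_sum]; ring
  have hsq : ‖ξ‖ ^ 2 ≤ ∑ i, ξ i ^ 2 := by
    have h1 : ‖ξ‖ ≤ √(∑ i, ξ i ^ 2) := by
      refine (pi_norm_le_iff_of_nonneg (Real.sqrt_nonneg _)).2 fun i => ?_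
      refine Real.le_sqrt_of_sq_le ?_
      rw [Real.norm_eq_abs, sq_abs]
      exact Finset.single_le_sum (f := fun i => ξ i ^ 2) (fun _ _ => sq_nonneg _) (Finset.mem_univ i)
    calc ‖ξ‖ ^ 2 ≤ √(∑ i, ξ i ^ 2) ^ 2 := by gcongr
      _ = _ := Real.sq_sqrt (Finset.sum_nonneg fun _ _ => sq_nonneg _)
  -- One ninth of the Gaussian is given up to absorb the factor (1 + π + √λ‖ξ‖)^j of D^j; eight
  -- ninths remain.
  have hexp : Real.exp (phase φ lam n ξ).re ≤
      Real.exp (-(M / 9 * (s * ‖ξ‖) ^ 2)) * Real.exp (-(8 / 9 * lam * M * ∑ i, ξ i ^ 2)) := by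
    rw [← Real.exp_add]
    refine Real.exp_le_exp.2 (hreph.trans ?_)
    rw [mul_pow, hs2]
    have : 0 ≤ lam * M * (∑ i, ξ i ^ 2 - ‖ξ‖ ^ 2) := by
      have := sub_nonneg.2 hsq; positivity
    nlinarith
  have habs := add_pow_mul_exp_le (b := 1 + Real.pi) (c := M / 9) (t := s * ‖ξ‖)
    (by positivity) (by positivity) (by positivity) hj
  have hfj : (j.factorial : ℝ) ≤ k.factorial := by exact_mod_cast Nat.factorial_le hj
  have hAj : A' ^ j ≤ A' ^ k := pow_le_pow_right₀ hA'1 hj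
  change ‖iteratedFDeriv ℝ j (Complex.exp ∘ phase φ lam n) ξ‖ ≤ _
  calc _ ≤ j.factorial * Real.exp (phase φ lam n ξ).re * D ^ j := hmain
    _ ≤ j.factorial * (Real.exp (-(M / 9 * (s * ‖ξ‖) ^ 2)) *
          Real.exp (-(8 / 9 * lam * M * ∑ i, ξ i ^ 2))) * D ^ j := by gcongr
    _ = j.factorial * A' ^ j * ((1 + Real.pi + s * ‖ξ‖) ^ j *
          Real.exp (-(M / 9 * (s * ‖ξ‖) ^ 2))) *
          (Real.exp (-(8 / 9 * lam * M * ∑ i, ξ i ^ 2)) * (1 + s) ^ j) := by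
        rw [hD, mul_pow (A' * (1 + s)), mul_pow A' (1 + s)]; ring
    _ ≤ k.factorial * A' ^ k * Real.exp (k * (1 + Real.pi) + k ^ 2 / (4 * (M / 9))) *
          (Real.exp (-(8 / 9 * lam * M * ∑ i, ξ i ^ 2)) * (1 + s) ^ j) := by gcongr
    _ = _ := by ring

end ExponentBounds

/-! ### The main estimate for the norm of e^{λφ}h -/

section Approximation

variable {d : ℕ}

theorem lt_two_mul_K (d : ℕ) : d < 2 * K d := by unfold K; omega

theorem wienerNorm_nonneg (f : (Fin d → ℝ) → ℂ) : 0 ≤ wienerNorm f :=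
  tsum_nonneg fun _ => norm_nonneg _

theorem fourierCoeff_add {f g : (Fin d → ℝ) → ℂ} (hf : Continuous f) (hg : Continuous g)
    (n : Fin d → ℤ) : fourierCoeff (f + g) n = fourierCoeff f n + fourierCoeff g n := by
  have hch := (contDiff_character (d := d) (-n) 0).continuous
  simp only [fourierCoeff, ← character_neg, Pi.add_apply, add_mul]
  rw [integral_add, mul_add]
  · exact (hf.mul hch).continuousOn.integrableOn_compact isCompact_Icc
  · exact (hg.mul hch).continuousOn.integrableOn_compact isCompact_Icc

theorem wienerNorm_add_le {f g : (Fin d → ℝ) → ℂ} (hf : MemWiener f) (hg : MemWiener g) :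
    wienerNorm (f + g) ≤ wienerNorm f + wienerNorm g := by
  have hle : ∀ n, ‖fourierCoeff (f + g) n‖ ≤ ‖fourierCoeff f n‖ + ‖fourierCoeff g n‖ := fun n => by
    rw [fourierCoeff_add hf.continuous hg.continuous]; exact norm_add_le _ _
  have hs := hf.summable.add hg.summable
  rw [wienerNorm, wienerNorm, wienerNorm, ← hf.summable.tsum_add hg.summable]
  exact Summable.tsum_le_tsum hle (Summable.of_nonneg_of_le (fun _ => norm_nonneg _) hle hs) hs

theorem memWiener_of_contDiff {f : (Fin d → ℝ) → ℂ} (hf : TorusPeriodic f)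
    (hc : ContDiff ℝ (K d : WithTop ℕ∞) f) : MemWiener f := by
  obtain ⟨C, -, h⟩ := exists_sobolev (lt_two_mul_K d)
  exact (h f 1 hf hc le_rfl).1

theorem exists_wienerNorm_le_of_derivBound (d : ℕ) :
    ∃ C : ℝ, 0 < C ∧ ∀ (f : (Fin d → ℝ) → ℂ) (a B κ : ℝ), TorusPeriodic f →
      ContDiff ℝ (K d : WithTop ℕ∞) f → 1 ≤ a → 0 ≤ B → 0 < κ →
      (∀ ξ, (∀ i, |ξ i| ≤ Real.pi) →
        DerivBound (K d) a (B * Real.exp (-(κ * ∑ i, ξ i ^ 2))) f ξ) →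
      wienerNorm f ≤ C * B * √((a / √κ) ^ d) := by
  obtain ⟨C, hC, h⟩ := exists_wienerNorm_le_of_gaussian (lt_two_mul_K d)
  refine ⟨C, hC, fun f a B κ hf hc ha hB hκ hb => (h f a B κ hf hc ha hB hκ
    (fun ξ hξ => (hb ξ hξ).norm_le) fun ξ hξ => ?_).2⟩
  refine (hb ξ hξ (K d) le_rfl).trans (le_of_eq ?_)
  ring

theorem torusPeriodic_exp_sumExponent {φ : Fin d → ℝ → ℂ}
    (hφ : ∀ i, Function.Periodic (φ i) (2 * Real.pi)) (lam : ℝ) :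
    TorusPeriodic fun ξ => Complex.exp ((lam : ℂ) * sumExponent φ ξ) := by
  intro ξ i
  have : sumExponent φ (ξ + Pi.single i (2 * Real.pi)) = sumExponent φ ξ := by
    refine Finset.sum_congr rfl fun l _ => ?_
    by_cases hl : l = i
    · subst hl; simpa using hφ l (ξ l)
    · simp [hl]
  simp only [this]

set_option maxHeartbeats 1000000 in
/-- The Wiener norm of `exp(lam φ) h`, for a function `h` vanishing to order `r` at the origin. -/
theorem exists_wienerNorm_exp_mul_le (hd : 1 ≤ d) {ρ : Fin d → Measure ℤ} {φ : Fin d → ℝ → ℂ}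
    (hprob : ∀ i, IsProbabilityMeasure (ρ i)) (hφ : ∀ i, IsLevyExponent (ρ i) (φ i))
    (hl : ∀ i, HasMinimalLattice (ρ i)) (hm : ∀ i, HasMoment (max 2 (K d)) (ρ i))
    {lam₀ : ℝ} (hlam₀ : 0 < lam₀) :
    ∃ C : ℝ, 0 < C ∧ ∀ (r : ℕ) (lam ε : ℝ) (h : (Fin d → ℝ) → ℂ), d / 2 ≤ r → lam₀ ≤ lam →
      0 < ε → ε < 1 → TorusPeriodic h → ContDiff ℝ ((r + 1 : ℕ) : WithTop ℕ∞) h →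
      (∀ n : ℕ, n ≤ r → ∀ s : Fin n → Fin d, partialDeriv s h 0 = 0) →
      MemWiener h ∧
      MemWiener ((fun ξ => Complex.exp ((lam : ℂ) * sumExponent φ ξ)) * h) ∧
      wienerNorm ((fun ξ => Complex.exp ((lam : ℂ) * sumExponent φ ξ)) * h) ≤
        C * (wienerNorm h * Real.exp (-(lam * decayM φ * ε ^ 2 / 4)) +
          ε ^ (r + 1) * betaSup (r + 1) h ε * √(((√lam + 1 / ε) / √lam) ^ d)) := by
  set M := decayM φ with hMdef
  have hM : 0 < M := decayM_pos hd hprob hφ hl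
  have hsm : ∀ i, ContDiff ℝ ((max 2 (K d) : ℕ) : WithTop ℕ∞) (φ i) := fun i => by
    have := hprob i; exact (hφ i).contDiff (hm i)
  have hsmK : ∀ i, ContDiff ℝ (K d : WithTop ℕ∞) (φ i) := fun i =>
    (hsm i).of_le (by norm_cast; omega)
  obtain ⟨C₀, hC₀, hgauss⟩ := exists_wienerNorm_le_of_derivBound d
  obtain ⟨Cw, hCw, hexp⟩ := exists_derivBound_exp_phase (k := K d) hM hsm (fun i => (hφ i).zero)
    (fun i θ => by have := hprob i; exact (hφ i).re_nonpos θ)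
    (fun i θ hθ => re_le_decayM hprob hφ i hθ)
  obtain ⟨Ck, hCk, hcut⟩ := exists_derivBound_cutoff (d := d) (K d)
  set q₀ : ℝ := (1 / √lam₀ + 1) / √(8 / 9 * M) with hq₀
  set Ct : ℝ := (d : ℝ) ^ K d * Real.exp d with hCt
  have hCt0 : 0 ≤ Ct := by positivity
  -- `D₁` serves the part away from the origin, `D₂` the case ε√λ ≤ 1, and `D₃` the part near the
  -- origin.
  set D₁ : ℝ := C₀ * (2 ^ K d * ((1 + Ck) * Cw)) * √((2 / √(4 / 9 * M)) ^ d) with hD₁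
  set D₂ : ℝ := C₀ * Cw * √(q₀ ^ d) * Real.exp (M / 4) with hD₂
  set D₃ : ℝ := C₀ * (2 ^ K d * (2 ^ K d * (Ck * Cw) * Ct)) * √((1 / √(8 / 9 * M)) ^ d) with hD₃
  have hD₁0 : 0 < D₁ := by positivity
  have hD₂0 : 0 < D₂ := by positivity
  have hD₃0 : 0 ≤ D₃ := by positivity
  refine ⟨D₁ + D₂ + D₃, by positivity, fun r lam ε h hr hlam hε hε1 hper hc hvan => ?_⟩
  have hlam0 : 0 < lam := hlam₀.trans_le hlam
  have hs0 : 0 < √lam := Real.sqrt_pos.2 hlam0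
  -- The condition r ≥ ⌊d/2⌋ says exactly that K ≤ r + 1.
  have hcK : ContDiff ℝ (K d : WithTop ℕ∞) h := hc.of_le (by unfold K; norm_cast; omega)
  have hβ := betaSup_nonneg (r + 1) h ε
  set E : (Fin d → ℝ) → ℂ := fun ξ => Complex.exp ((lam : ℂ) * sumExponent φ ξ) with hE
  have hEper : TorusPeriodic E := torusPeriodic_exp_sumExponent (fun i => (hφ i).periodic) lam
  have hEc : ContDiff ℝ (K d : WithTop ℕ∞) E :=
    (contDiff_const.mul (contDiff_sumExponent hsmK)).cexp
  have hhW := memWiener_of_contDiff hper hcK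
  refine ⟨hhW, memWiener_of_contDiff (hEper.mul hper) (hEc.mul hcK), ?_⟩
  obtain ⟨n, hW⟩ := hexp lam hlam0
  set W : (Fin d → ℝ) → ℂ := fun ξ => Complex.exp (phase φ lam n ξ) with hWdef
  have hWE : W = E * character (-n) := funext fun ξ => exp_phase lam n ξ
  have hWper : TorusPeriodic W := hWE ▸ hEper.mul (torusPeriodic_character _)
  have hWc : ContDiff ℝ (K d : WithTop ℕ∞) W := hWE ▸ hEc.mul (contDiff_character _ _)
  have hnorm : wienerNorm (E * h) = wienerNorm (h * W) := by
    rw [← wienerNorm_mul_character (E * h) (-n), hWE]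
    congr 1; ring
  rw [hnorm]
  have hhN := wienerNorm_nonneg h
  have hκ : √(8 / 9 * lam * M) = √lam * √(8 / 9 * M) := by
    rw [← Real.sqrt_mul hlam0.le]; congr 1; ring
  have hκ2 : √(4 / 9 * lam * M) = √lam * √(4 / 9 * M) := by
    rw [← Real.sqrt_mul hlam0.le]; congr 1; ring
  have hsecond : 0 ≤ ε ^ (r + 1) * betaSup (r + 1) h ε * √(((√lam + 1 / ε) / √lam) ^ d) := by
    positivity
  have hfirst : 0 ≤ wienerNorm h * Real.exp (-(lam * M * ε ^ 2 / 4)) := by positivity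
  -- If ε√λ ≤ 1, the factor e^{−λMε²/4} is at least e^{−M/4}, so boundedness of the norm of W
  -- suffices. Otherwise 1/ε ≤ √λ, and the cutoff raises the frequency scale to at most 2√λ.
  rcases le_total (ε * √lam) 1 with hcase | hcase
  · have hWn : wienerNorm W ≤ C₀ * Cw * √(q₀ ^ d) := by
      refine (hgauss W (1 + √lam) Cw (8 / 9 * lam * M) hWper hWc (by linarith) hCw.le
        (by positivity) hW).trans ?_
      have : (1 + √lam) / √(8 / 9 * lam * M) ≤ q₀ := by
        rw [hκ, hq₀, ← div_div, add_div, div_self hs0.ne']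
        gcongr
      gcongr
    have he : Real.exp (-(M / 4)) ≤ Real.exp (-(lam * M * ε ^ 2 / 4)) := by
      refine Real.exp_le_exp.2 (neg_le_neg ?_)
      have h1 : (ε * √lam) ^ 2 ≤ 1 := pow_le_one₀ (by positivity) hcase
      rw [mul_pow, Real.sq_sqrt hlam0.le] at h1
      nlinarith
    calc wienerNorm (h * W) ≤ wienerNorm h * wienerNorm W :=
          wienerNorm_mul_le hhW (memWiener_of_contDiff hWper hWc)
      _ ≤ wienerNorm h * (C₀ * Cw * √(q₀ ^ d)) := by gcongr
      _ = D₂ * (wienerNorm h * Real.exp (-(M / 4))) := by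
          have : Real.exp (M / 4) * Real.exp (-(M / 4)) = 1 := by
            rw [← Real.exp_add, add_neg_cancel, Real.exp_zero]
          rw [hD₂]
          linear_combination (-(wienerNorm h * (C₀ * Cw * √(q₀ ^ d)))) * this
      _ ≤ D₂ * (wienerNorm h * Real.exp (-(lam * M * ε ^ 2 / 4))) := by gcongr
      _ ≤ _ := by
          refine mul_le_mul (by linarith) (by linarith) (by positivity) (by positivity)
  set a : ℝ := √lam + 1 / ε with ha
  have hinv : 1 ≤ 1 / ε := (one_le_div hε).2 hε1.le
  have ha1 : 1 ≤ a := by linarith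
  have hkper := torusPeriodic_cutoff (d := d) ε
  have hkc := contDiff_cutoff (d := d) ε (K d)
  have hone : ContDiff ℝ (K d : WithTop ℕ∞) (1 : (Fin d → ℝ) → ℂ) := contDiff_const
  have hWa : ∀ ξ : Fin d → ℝ, (∀ i, |ξ i| ≤ Real.pi) → DerivBound (K d) a
      (Cw * Real.exp (-(8 / 9 * lam * M * ∑ i, ξ i ^ 2))) W ξ := fun ξ hξ =>
    (hW ξ hξ).mono (by positivity) (by linarith) (by positivity) le_rfl
  have hka : ∀ ξ : Fin d → ℝ, (∀ i, |ξ i| ≤ Real.pi) → DerivBound (K d) a Ck (cutoff ε) ξ :=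
    fun ξ hξ => (hcut ε hε hε1 ξ hξ).mono (by positivity) (by linarith) (by linarith) le_rfl
  have hsplit : h * W = h * ((1 - cutoff ε) * W) + cutoff ε * W * h := by ring
  have houtper : TorusPeriodic ((1 - cutoff (d := d) ε) * W) :=
    (TorusPeriodic.sub (fun _ _ => rfl) hkper).mul hWper
  have houtc : ContDiff ℝ (K d : WithTop ℕ∞) ((1 - cutoff (d := d) ε) * W) :=
    (hone.sub hkc).mul hWc
  have hout : wienerNorm ((1 - cutoff ε) * W) ≤ D₁ * Real.exp (-(lam * M * ε ^ 2 / 4)) := by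
    refine (hgauss _ a (2 ^ K d * ((1 + Ck) * Cw) * Real.exp (-(lam * M * ε ^ 2 / 4)))
      (4 / 9 * lam * M) houtper houtc ha1 (by positivity) (by positivity) ?_).trans ?_
    · intro ξ hξ
      by_cases hin : ∀ l, |ξ l| < 3 / 4 * ε
      · refine derivBound_of_eventuallyEq_zero ?_ (by linarith) (by positivity)
        have hopen : ∀ᶠ η in nhds ξ, ∀ l, |η l| < 3 / 4 * ε := by
          rw [Filter.eventually_all]
          intro l
          exact ((continuous_apply l).abs.continuousAt (x := ξ)).eventually (gt_mem_nhds (hin l))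
        filter_upwards [hopen] with η hη
        simp [cutoff_eq_one hε fun l => (hη l).le]
      · push Not at hin
        obtain ⟨l, hl⟩ := hin
        have hS : 9 / 16 * ε ^ 2 ≤ ∑ i, ξ i ^ 2 := by
          refine le_trans ?_ (Finset.single_le_sum (f := fun i => ξ i ^ 2)
            (fun _ _ => sq_nonneg _) (Finset.mem_univ l))
          calc 9 / 16 * ε ^ 2 = (3 / 4 * ε) ^ 2 := by ring
            _ ≤ |ξ l| ^ 2 := by gcongr
            _ = ξ l ^ 2 := sq_abs _
        have hb := ((derivBound_one (by linarith) ξ).sub (hka ξ hξ) hone hkc).mul (hWa ξ hξ)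
          (hone.sub hkc) hWc (by linarith) (by linarith) (by positivity)
        refine hb.mono (by linarith) le_rfl (by positivity) ?_
        -- Half of the exponent 8/9 is spent where |ξ_l| ≥ 3ε/4 for some l: 4/9 · 9/16 = 1/4. The
        -- other half keeps a Gaussian for the norm estimate.
        have he : Real.exp (-(8 / 9 * lam * M * ∑ i, ξ i ^ 2)) ≤
            Real.exp (-(lam * M * ε ^ 2 / 4)) * Real.exp (-(4 / 9 * lam * M * ∑ i, ξ i ^ 2)) := by
          rw [← Real.exp_add]
          refine Real.exp_le_exp.2 ?_
          have : 0 ≤ lam * M * (∑ i, ξ i ^ 2 - 9 / 16 * ε ^ 2) := by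
            have := sub_nonneg.2 hS; positivity
          nlinarith
        calc _ = 2 ^ K d * ((1 + Ck) * Cw) * Real.exp (-(8 / 9 * lam * M * ∑ i, ξ i ^ 2)) := by
              ring
          _ ≤ 2 ^ K d * ((1 + Ck) * Cw) * (Real.exp (-(lam * M * ε ^ 2 / 4)) *
                Real.exp (-(4 / 9 * lam * M * ∑ i, ξ i ^ 2))) := by gcongr
          _ = _ := by ring
    · have h1 : a / √(4 / 9 * lam * M) ≤ 2 / √(4 / 9 * M) := by
        rw [hκ2, ← div_div]
        gcongr
        rw [div_le_iff₀ hs0, ha]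
        have : 1 / ε ≤ √lam := by rw [div_le_iff₀ hε]; linarith
        linarith
      calc _ ≤ C₀ * (2 ^ K d * ((1 + Ck) * Cw) * Real.exp (-(lam * M * ε ^ 2 / 4))) *
            √((2 / √(4 / 9 * M)) ^ d) := by gcongr
        _ = _ := by rw [hD₁]; ring
  have hinper : TorusPeriodic (cutoff ε * W * h) := (hkper.mul hWper).mul hper
  have hinc : ContDiff ℝ (K d : WithTop ℕ∞) (cutoff ε * W * h) := (hkc.mul hWc).mul hcK
  have hin : wienerNorm (cutoff ε * W * h) ≤
      D₃ * (ε ^ (r + 1) * betaSup (r + 1) h ε * √((a / √lam) ^ d)) := by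
    refine (hgauss _ a (2 ^ K d * (2 ^ K d * (Ck * Cw) * Ct) *
      (ε ^ (r + 1) * betaSup (r + 1) h ε)) (8 / 9 * lam * M) hinper hinc ha1 (by positivity)
      (by positivity) ?_).trans (le_of_eq ?_)
    · intro ξ hξ
      by_cases hsmall : ∀ l, |ξ l| ≤ ε
      · have ht := (derivBound_of_taylor hd (k := K d) (by unfold K; omega) hc hvan hε
          hsmall).mono (b := a) (by positivity) (by linarith) (by positivity) le_rfl
        have hb := (((hka ξ hξ).mul (hWa ξ hξ) hkc hWc (by linarith) (by linarith)
          (by positivity)).mul ht (hkc.mul hWc) hcK (by linarith) (by positivity) (by positivity))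
        refine hb.mono (by linarith) le_rfl (by positivity) (le_of_eq ?_)
        rw [hCt]; ring
      · push Not at hsmall
        obtain ⟨l, hl⟩ := hsmall
        refine derivBound_of_eventuallyEq_zero ?_ (by linarith) (by positivity)
        filter_upwards [cutoff_eventuallyEq_zero hε hε1 hl (hξ l)] with η hη
        simp [hη]
    · rw [hκ, ← div_div, div_eq_mul_one_div (a / √lam), mul_pow, Real.sqrt_mul (by positivity), hD₃]
      ring
  have houtW := memWiener_of_contDiff houtper houtc
  calc wienerNorm (h * W)
      ≤ wienerNorm (h * ((1 - cutoff ε) * W)) + wienerNorm (cutoff ε * W * h) := by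
        rw [hsplit]
        exact wienerNorm_add_le (memWiener_of_contDiff (hper.mul houtper) (hcK.mul houtc))
          (memWiener_of_contDiff hinper hinc)
    _ ≤ wienerNorm h * (D₁ * Real.exp (-(lam * M * ε ^ 2 / 4))) +
          D₃ * (ε ^ (r + 1) * betaSup (r + 1) h ε * √((a / √lam) ^ d)) := by
        refine add_le_add ((wienerNorm_mul_le hhW houtW).trans ?_) hin
        gcongr
    _ ≤ (D₁ + D₂ + D₃) * (wienerNorm h * Real.exp (-(lam * M * ε ^ 2 / 4))) +
          (D₁ + D₂ + D₃) * (ε ^ (r + 1) * betaSup (r + 1) h ε * √((a / √lam) ^ d)) := by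
        refine add_le_add ?_ (by gcongr; linarith)
        calc _ = D₁ * (wienerNorm h * Real.exp (-(lam * M * ε ^ 2 / 4))) := by ring
          _ ≤ _ := by gcongr; linarith
    _ = _ := by ring

end Approximation

/-! ### Powers and logarithms of λ -/

section Rates

variable {d : ℕ}

theorem ResidueScheme.fourier_sub {φ : Fin d → ℝ → ℂ} {r : ℕ} {lam : ℝ}
    {μ ν : SignedMeasure (Fin d → ℤ)} {ψ χ : (Fin d → ℝ) → ℂ}
    (h : ResidueScheme φ r lam μ ν ψ χ) :
    fourier μ - fourier ν = (fun ξ => Complex.exp ((lam : ℂ) * sumExponent φ ξ)) * (ψ - χ) := by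
  ext ξ
  simp only [Pi.sub_apply, Pi.mul_apply, h.fourier_left, h.fourier_right]
  ring

theorem sqrt_sqrt_pow {x : ℝ} (hx : 0 ≤ x) (d : ℕ) : √(√x ^ d) = x ^ ((d : ℝ) / 4) := by
  rw [Real.sqrt_eq_rpow x, ← Real.rpow_natCast, ← Real.rpow_mul hx, Real.sqrt_eq_rpow,
    ← Real.rpow_mul hx]
  congr 1; ring

/-- The sharper exponent d/2 is given away for K to reach the form of the bound in claim (1). -/
theorem sqrt_pow_le_pow_K {a : ℝ} (ha : 1 ≤ a) : √(a ^ d) ≤ a ^ K d := by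
  rw [Real.sqrt_le_iff]
  refine ⟨by positivity, ?_⟩
  rw [← pow_mul]
  exact pow_le_pow_right₀ ha (by have := lt_two_mul_K d; omega)

theorem eventually_logarithmic_scale {κ ε : ℝ} (hε : 0 < ε) :
    ∀ᶠ x : ℝ in Filter.atTop, 1 ≤ Real.log x ∧ κ * Real.log x / √x < ε := by
  have h1 : Filter.Tendsto (fun x : ℝ => κ * (Real.log x / x ^ (1 / 2 : ℝ))) Filter.atTop
      (nhds (κ * 0)) :=
    ((isLittleO_log_rpow_atTop (by norm_num : (0 : ℝ) < 1 / 2)).tendsto_div_nhds_zero).const_mul κ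
  rw [mul_zero] at h1
  filter_upwards [Real.tendsto_log_atTop.eventually_ge_atTop 1, h1.eventually (gt_mem_nhds hε)]
    with x hx1 hx2
  refine ⟨hx1, ?_⟩
  rwa [Real.sqrt_eq_rpow, mul_div_assoc]

/-- At radius κ log x/√x the exponent is −(Mκ²/4) log² x, and both κ ≥ 1 and log x ≥ 1 may be used
to lower it to a multiple of log x. -/
theorem exp_neg_sq_log_le {M κ c x : ℝ} (hM : 0 ≤ M) (hκ : 1 ≤ κ) (hx : 0 < x)
    (hlog : 1 ≤ Real.log x) (hc : c ≤ M * κ / 4) :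
    Real.exp (-(x * M * (κ * Real.log x / √x) ^ 2 / 4)) ≤ (x ^ c)⁻¹ := by
  have h1 : x * M * (κ * Real.log x / √x) ^ 2 / 4 = M * κ / 4 * κ * Real.log x ^ 2 := by
    rw [div_pow, Real.sq_sqrt hx.le]; field_simp
  rw [← Real.rpow_neg hx.le, Real.rpow_def_of_pos hx, h1]
  refine Real.exp_le_exp.2 ?_
  have h2 : 0 ≤ M * κ / 4 := by positivity
  have h3 : c * Real.log x ≤ M * κ / 4 * Real.log x := by gcongr
  have h4 : M * κ / 4 * Real.log x ≤ M * κ / 4 * (κ * Real.log x ^ 2) := by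
    gcongr; nlinarith
  linarith

end Rates

end MultiWiener

end

/-! ### The two estimates -/

theorem theorem5 (d : ℕ) (hd : 1 ≤ d)
    (ρ : Fin d → MeasureTheory.Measure ℤ)
    (hprob : ∀ i, MeasureTheory.IsProbabilityMeasure (ρ i))
    (φ : Fin d → ℝ → ℂ)
    (hφ : ∀ i, MultiWiener.IsLevyExponent (ρ i) (φ i))
    (hlattice : ∀ i, MultiWiener.HasMinimalLattice (ρ i))
    (hmoment : ∀ i, MultiWiener.HasMoment (max 2 (MultiWiener.K d)) (ρ i)) :
    (∀ lam₀ : ℝ, 0 < lam₀ → ∃ C₁ C₂ : ℝ, 0 < C₁ ∧ 0 < C₂ ∧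
      ∀ (r : ℕ) (lam ε : ℝ) (μ ν : MeasureTheory.SignedMeasure (Fin d → ℤ))
        (ψ χ : (Fin d → ℝ) → ℂ),
        d / 2 ≤ r → lam₀ ≤ lam → 0 < ε → ε < 1 →
        (∀ i, MultiWiener.gammaSup φ ε ≤ MultiWiener.sigmaSq (φ i) / 2) →
        MultiWiener.ResidueScheme φ r lam μ ν ψ χ →
        MultiWiener.MemWiener (ψ - χ) ∧
        MultiWiener.MemWiener (MultiWiener.fourier μ - MultiWiener.fourier ν) ∧
        MultiWiener.wienerNorm (MultiWiener.fourier μ - MultiWiener.fourier ν) ≤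
          C₁ * (MultiWiener.wienerNorm (ψ - χ) *
                (lam ^ MultiWiener.K d *
                  Real.exp (-(lam * MultiWiener.decayM φ * ε ^ 2 / 4)) / ε)
              + ε ^ (r + 1) * MultiWiener.betaSup (r + 1) (ψ - χ) ε / lam ^ ((d : ℝ) / 4) *
                (Real.sqrt lam + 1 / ε) ^ MultiWiener.K d)
            * (1 + C₂ / Real.sqrt lam)) ∧
    (∀ r : ℕ, d / 2 ≤ r → ∃ C₃ : ℝ, 0 < C₃ ∧
      ∀ ε : ℝ, 0 < ε → ∃ lam₁ : ℝ, 2 ≤ lam₁ ∧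
        ∀ (lam : ℝ) (μ ν : MeasureTheory.SignedMeasure (Fin d → ℤ))
          (ψ χ : (Fin d → ℝ) → ℂ),
          lam₁ ≤ lam →
          MultiWiener.ResidueScheme φ r lam μ ν ψ χ →
          MultiWiener.MemWiener (ψ - χ) ∧
          MultiWiener.MemWiener (MultiWiener.fourier μ - MultiWiener.fourier ν) ∧
          MultiWiener.wienerNorm (MultiWiener.fourier μ - MultiWiener.fourier ν) ≤
            C₃ * (MultiWiener.wienerNorm (ψ - χ) + MultiWiener.betaSup (r + 1) (ψ - χ) ε) *
              (Real.log lam ^ (r + 1) / lam ^ ((r : ℝ) / 2 + 1 / 4))) := by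
  constructor
  · intro lam₀ hlam₀
    obtain ⟨C, hC, hmain⟩ := MultiWiener.exists_wienerNorm_exp_mul_le hd hprob hφ hlattice hmoment
      hlam₀
    -- The main estimate has no factor λ^K/ε; it is inserted at the cost of λ₀^{-K}, since λ ≥ λ₀
    -- and ε < 1. The factor 1 + C₂/√λ is at least 1, so any C₂ > 0 will do.
    refine ⟨C * (1 + (lam₀ ^ MultiWiener.K d)⁻¹), 1, by positivity, one_pos, ?_⟩
    intro r lam ε μ ν ψ χ hr hlam hε hε1 _ hS
    obtain ⟨h1, h2, h3⟩ := hmain r lam ε (ψ - χ) hr hlam hε hε1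
      (hS.periodic_left.sub hS.periodic_right) (hS.contDiff_left.sub hS.contDiff_right) hS.taylor
    rw [hS.fourier_sub]
    refine ⟨h1, h2, h3.trans ?_⟩
    have hlam0 : 0 < lam := hlam₀.trans_le hlam
    have hs0 : 0 < √lam := Real.sqrt_pos.2 hlam0
    set L := (lam₀ ^ MultiWiener.K d)⁻¹ with hL
    have hL0 : 0 < L := by positivity
    set e := Real.exp (-(lam * MultiWiener.decayM φ * ε ^ 2 / 4)) with he
    have he0 : 0 < e := Real.exp_pos _
    have hN := MultiWiener.wienerNorm_nonneg (ψ - χ)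
    have hβ := MultiWiener.betaSup_nonneg (r + 1) (ψ - χ) ε
    have hinv : 1 ≤ 1 / ε := (one_le_div hε).2 hε1.le
    have hfirst : e ≤ (1 + L) * (lam ^ MultiWiener.K d * e / ε) := by
      have h4 : 1 ≤ L * lam ^ MultiWiener.K d := by
        rw [hL, le_inv_mul_iff₀ (by positivity), mul_one]
        gcongr
      have h5 : 1 ≤ L * lam ^ MultiWiener.K d * (1 / ε) := one_le_mul_of_one_le_of_one_le h4 hinv
      have h6 : 0 ≤ lam ^ MultiWiener.K d * e / ε := by positivity
      calc e ≤ L * lam ^ MultiWiener.K d * (1 / ε) * e := le_mul_of_one_le_left he0.le h5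
        _ = L * (lam ^ MultiWiener.K d * e / ε) := by ring
        _ ≤ _ := by gcongr; linarith
    have hsecond : √(((√lam + 1 / ε) / √lam) ^ d) ≤
        (1 + L) * ((√lam + 1 / ε) ^ MultiWiener.K d / lam ^ ((d : ℝ) / 4)) := by
      rw [div_pow, Real.sqrt_div (by positivity), MultiWiener.sqrt_sqrt_pow hlam0.le]
      calc _ ≤ (√lam + 1 / ε) ^ MultiWiener.K d / lam ^ ((d : ℝ) / 4) := by
            gcongr
            exact MultiWiener.sqrt_pow_le_pow_K (by linarith)
        _ ≤ _ := le_mul_of_one_le_left (by positivity) (by linarith)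
    calc _ ≤ C * (MultiWiener.wienerNorm (ψ - χ) *
            ((1 + L) * (lam ^ MultiWiener.K d * e / ε)) +
          ε ^ (r + 1) * MultiWiener.betaSup (r + 1) (ψ - χ) ε *
            ((1 + L) * ((√lam + 1 / ε) ^ MultiWiener.K d / lam ^ ((d : ℝ) / 4)))) := by gcongr
      _ = C * (1 + L) * (MultiWiener.wienerNorm (ψ - χ) * (lam ^ MultiWiener.K d * e / ε) +
          ε ^ (r + 1) * MultiWiener.betaSup (r + 1) (ψ - χ) ε / lam ^ ((d : ℝ) / 4) *
            (√lam + 1 / ε) ^ MultiWiener.K d) := by ring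
      _ ≤ _ := le_mul_of_one_le_right (by positivity)
          (le_add_of_nonneg_right (by positivity))
  · intro r hr
    obtain ⟨C, hC, hmain⟩ := MultiWiener.exists_wienerNorm_exp_mul_le hd hprob hφ hlattice hmoment
      one_pos
    have hM := MultiWiener.decayM_pos hd hprob hφ hlattice
    set M := MultiWiener.decayM φ with hMdef
    -- Chosen so that Mκ = M + 2r + 1, hence Mκ/4 exceeds the exponent r/2 + 1/4 of the rate.
    set κ : ℝ := 1 + (2 * r + 1) / M with hκ
    have hκ1 : 1 ≤ κ := le_add_of_nonneg_right (by positivity)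
    have hκM : (r : ℝ) / 2 + 1 / 4 ≤ M * κ / 4 := by
      have : M * κ = M + (2 * r + 1) := by rw [hκ]; field_simp
      rw [this]; linarith
    refine ⟨C * (κ ^ (r + 1) * √(2 ^ d)), by positivity, fun ε hε => ?_⟩
    obtain ⟨x₀, hx₀⟩ := Filter.eventually_atTop.1
      (MultiWiener.eventually_logarithmic_scale (κ := κ) (lt_min one_pos hε))
    refine ⟨max 2 x₀, le_max_left _ _, fun lam μ ν ψ χ hlam hS => ?_⟩
    have hlam2 : 2 ≤ lam := (le_max_left _ _).trans hlam
    obtain ⟨hlog, hsmall⟩ := hx₀ lam ((le_max_right _ _).trans hlam)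
    have hlam0 : 0 < lam := by linarith
    have hs0 : 0 < √lam := Real.sqrt_pos.2 hlam0
    -- The main estimate is applied at this radius instead of ε. Since δ < min(1, ε) for large λ,
    -- monotonicity of β brings back the given ε, which may exceed 1.
    set δ := κ * Real.log lam / √lam with hδ
    have hδ0 : 0 < δ := by positivity
    have hc := hS.contDiff_left.sub hS.contDiff_right
    obtain ⟨h1, h2, h3⟩ := hmain r lam δ (ψ - χ) hr (by linarith) hδ0
      (hsmall.trans_le (min_le_left _ _)) (hS.periodic_left.sub hS.periodic_right) hc hS.taylor
    rw [hS.fourier_sub]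
    refine ⟨h1, h2, h3.trans ?_⟩
    have hN := MultiWiener.wienerNorm_nonneg (ψ - χ)
    have hβ := MultiWiener.betaSup_nonneg (r + 1) (ψ - χ) δ
    have hβ2 : MultiWiener.betaSup (r + 1) (ψ - χ) δ ≤ MultiWiener.betaSup (r + 1) (ψ - χ) ε :=
      MultiWiener.betaSup_mono hc (hsmall.le.trans (min_le_right _ _))
    have hβε := hβ.trans hβ2
    have hlogp : 1 ≤ Real.log lam ^ (r + 1) := one_le_pow₀ hlog
    have hκp : 1 ≤ κ ^ (r + 1) := one_le_pow₀ hκ1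
    have h2d : 1 ≤ √((2 : ℝ) ^ d) := by
      rw [Real.one_le_sqrt]; exact one_le_pow₀ (by norm_num)
    set R := Real.log lam ^ (r + 1) / lam ^ ((r : ℝ) / 2 + 1 / 4) with hR
    have hR0 : 0 < R := by positivity
    have hfirst : Real.exp (-(lam * M * δ ^ 2 / 4)) ≤ κ ^ (r + 1) * √(2 ^ d) * R := by
      calc _ ≤ (lam ^ ((r : ℝ) / 2 + 1 / 4))⁻¹ :=
            MultiWiener.exp_neg_sq_log_le hM.le hκ1 hlam0 hlog hκM
        _ ≤ R := by rw [hR, div_eq_mul_inv]; exact le_mul_of_one_le_left (by positivity) hlogp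
        _ ≤ _ := le_mul_of_one_le_left hR0.le (one_le_mul_of_one_le_of_one_le hκp h2d)
    -- The power λ^{−(r+1)/2} is better than the rate claimed by a factor λ^{1/4}.
    have hpow : δ ^ (r + 1) ≤ κ ^ (r + 1) * R := by
      rw [hδ, div_pow, mul_pow, hR, ← mul_div_assoc]
      gcongr
      rw [Real.sqrt_eq_rpow, ← Real.rpow_natCast, ← Real.rpow_mul hlam0.le]
      refine Real.rpow_le_rpow_of_exponent_le (by linarith) ?_
      push_cast; linarith
    -- As κ log λ ≥ 1, the radius δ is at least 1/√λ, so the cutoff at most doubles the frequency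
    -- scale.
    have hratio : √(((√lam + 1 / δ) / √lam) ^ d) ≤ √(2 ^ d) := by
      gcongr
      rw [div_le_iff₀ hs0]
      have : 1 / δ ≤ √lam := by
        rw [hδ, one_div_div, div_le_iff₀ (by positivity)]
        exact le_mul_of_one_le_right hs0.le (one_le_mul_of_one_le_of_one_le hκ1 hlog)
      linarith
    calc _ ≤ C * (MultiWiener.wienerNorm (ψ - χ) * (κ ^ (r + 1) * √(2 ^ d) * R) +
          κ ^ (r + 1) * R * MultiWiener.betaSup (r + 1) (ψ - χ) ε * √(2 ^ d)) := by gcongr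
      _ = _ := by ring
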